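/- Let $d\ge 1$, let $\Omega\subset\mathbb R^d$ be a bounded domain with smooth boundary $\Gamma=\partial\Omega$, and let $T>0$, $Q=\Omega\times(0,T)$. Put $V=H^1(\Omega)$, $H=L^2(\Omega)$, $H_\Gamma=L^2(\Gamma)$, and $W_\Gamma=H^{1/2}(\Gamma)$, the space of traces $z|_\Gamma$ of functions $z\in V$. Identify $H$ and $H_\Gamma$ with their duals, so that $V\subset H\subset V^*$ and $W_\Gamma\subset H_\Gamma\subset W_\Gamma^*$. Let $\hat\beta,\hat\beta_\Gamma:\mathbb R\to[0,+\infty]$ be convex, proper and lower semicontinuous with $\hat\beta(0)=\hat\beta_\Gamma(0)=0$, let $\beta=\partial\hat\beta$ be the subdifferential in $\mathbb R\times\mathbb R$, and let $\pi,\pi_\Gamma:\mathbb R\to\mathbb R$ be Lipschitz continuous with constants $L$ and $L_\Gamma$. For $z\in W_\Gamma$ let $\Psi(z)=\int_\Gamma\hat\beta_\Gamma(z)$ if $\hat\beta_\Gamma(z)\in L^1(\Gamma)$ and $\Psi(z)=+\infty$ otherwise, and let $\partial\Psi:W_\Gamma\to 2^{W_\Gamma^*}$ be its subdifferential: $\rho\in\partial\Psi(z)$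 if and only if $\Psi(z)<+\infty$ and $\Psi(z)\le\langle\rho,z-w\rangle+\Psi(w)$ for all $w\in W_\Gamma$. For data $f\in L^2(0,T;H)$, $f_\Gamma\in L^2(0,T;H_\Gamma)$, $u_0\in H$, $v_0\in H_\Gamma$, a solution is a quadruplet $(u,v,\xi,\xi_\Gamma)$ such that $$u\in L^2(0,T;V)\cap H^1(0,T;V^*),\qquad v=u|_\Gamma\in L^2(0,T;W_\Gamma)\cap H^1(0,T;W_\Gamma^*),$$ $$\xi\in L^2(0,T;H),\quad \xi\in\beta(u)\ \text{a.e. in }Q,\qquad \xi_\Gamma\in L^2(0,T;W_\Gamma^*),\quad \xi_\Gamma(t)\in\partial\Psi(v(t))\ \text{for a.e. }t\in(0,T),$$ $u(0)=u_0$ and $v(0)=v_0$ (for the continuous representatives $u\in C^0([0,T];H)$, $v\in C^0([0,T];H_\Gamma)$), and, for a.e. $t\in(0,T)$ and every $z\in V$, $$\langle\partial_tu(t),z\rangle_{V^*,V}+\int_\Omega\nabla u(t)\cdot\nabla z+\int_\Omega(\xi(t)+\pi(u(t)))z+\langle\partial_tv(t),z|_\Gamma\rangle_{W_\Gamma^*,W_\Gamma}+\int_\Gamma\pi_\Gamma(v(t))z+\langle\xi_\Gamma(t),z|_\Gamma\rangle_{W_\Gamma^*,W_\Gamma}=\int_\Omega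 f(t)z+\int_\Gamma f_\Gamma(t)z .$$ Then there is a constant $c$, depending only on $\Omega,T,L,L_\Gamma$, such that for any two sets of data $(f_i,f_{\Gamma,i},u_{0,i},v_{0,i})$ and any corresponding solutions $(u_i,v_i,\xi_i,\xi_{\Gamma,i})$, $i=1,2$, $$\|u_1-u_2\|^2_{L^\infty(0,T;H)}+\|\nabla(u_1-u_2)\|^2_{L^2(Q)}+\|v_1-v_2\|^2_{L^\infty(0,T;H_\Gamma)}$$ $$\le c\,\Big\{\|u_{0,1}-u_{0,2}\|^2_H+\|v_{0,1}-v_{0,2}\|^2_{H_\Gamma}+\|f_1-f_2\|^2_{L^2(0,T;H)}+\|f_{\Gamma,1}-f_{\Gamma,2}\|^2_{L^2(0,T;H_\Gamma)}\Big\}.$$ Moreover, any two solutions $(u,v,\xi,\xi_\Gamma)$ with the same data coincide (in all four components). -/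

import Mathlib

open MeasureTheory Set
open scoped ENNReal NNReal ContDiff

noncomputable section

namespace AllenCahn

/-! ### The domain and the Lebesgue spaces -/

/-- The Euclidean space `ℝ^d`. -/
abbrev Euc (d : ℕ) := EuclideanSpace ℝ (Fin d)

variable {d : ℕ}

/-- `Ω` is a bounded domain (nonempty, open, connected) with smooth boundary: near every boundary
point there is a smooth change of coordinates that maps `Ω` to a half space `{y | 0 < y i}`
(and hence, locally, `∂Ω` to the hyperplane `{y | y i = 0}`). -/
structure IsSmoothBoundedDomain (Ω : Set (Euc d)) : Prop where
  isOpen : IsOpen Ω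
  isConnected : IsConnected Ω
  isBounded : Bornology.IsBounded Ω
  smooth_boundary : ∀ x ∈ frontier Ω, ∃ Φ : OpenPartialHomeomorph (Euc d) (Euc d),
    x ∈ Φ.source ∧ ContDiffOn ℝ ∞ Φ Φ.source ∧ ContDiffOn ℝ ∞ Φ.symm Φ.target ∧
      ∃ i : Fin d, Φ.IsImage Ω {y | 0 < y i}

/-- The surface measure on `Γ = ∂Ω`: the `(d-1)`-dimensional Hausdorff measure, normalized so that
it agrees with Lebesgue measure on `(d-1)`-dimensional planes. -/
def surf (Ω : Set (Euc d)) : Measure (Euc d) :=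
  (Measure.euclideanHausdorffMeasure (d - 1)).restrict (frontier Ω)

/-- `H = L²(Ω)`. -/
abbrev L2 (Ω : Set (Euc d)) := Lp ℝ 2 (volume.restrict Ω)

/-- `L²(Ω)^d`, in which gradients live. -/
abbrev L2Vec (Ω : Set (Euc d)) := Lp (Euc d) 2 (volume.restrict Ω)

/-- `H_Γ = L²(Γ)`. -/
abbrev L2Bdry (Ω : Set (Euc d)) := Lp ℝ 2 (surf Ω)

/-! ### The Sobolev space `V = H¹(Ω)` -/

/-- `G` is the weak gradient of `u` in `Ω`. -/
def IsWeakGradient (Ω : Set (Euc d)) (u : Euc d → ℝ) (G : Euc d → Euc d) : Prop :=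
  ∀ φ : Euc d → ℝ, ContDiff ℝ ∞ φ → HasCompactSupport φ → tsupport φ ⊆ Ω →
    ∫ x in Ω, u x • gradient φ x = -∫ x in Ω, φ x • G x

lemma integrable_smul_gradient (Ω : Set (Euc d)) (u : L2 Ω) {φ : Euc d → ℝ}
    (h : ContDiff ℝ ∞ φ) (hc : HasCompactSupport φ) :
    Integrable (fun x => u x • gradient φ x) (volume.restrict Ω) := by
  have h1 : Continuous (gradient φ) :=
    (InnerProductSpace.toDual ℝ (Euc d)).symm.continuous.comp (h.continuous_fderiv (by simp))
  have h2 : HasCompactSupport (gradient φ) :=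
    (hc.fderiv (𝕜 := ℝ)).comp_left (g := (InnerProductSpace.toDual ℝ (Euc d)).symm) (map_zero _)
  have h3 : MemLp (gradient φ) 2 (volume.restrict Ω) := h1.memLp_of_hasCompactSupport h2
  exact memLp_one_iff_integrable.1 (h3.smul (Lp.memLp u))

lemma integrable_smul_vec (Ω : Set (Euc d)) (G : L2Vec Ω) {φ : Euc d → ℝ}
    (h : ContDiff ℝ ∞ φ) (hc : HasCompactSupport φ) :
    Integrable (fun x => φ x • G x) (volume.restrict Ω) := by
  have h3 : MemLp φ 2 (volume.restrict Ω) := h.continuous.memLp_of_hasCompactSupport hc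
  exact memLp_one_iff_integrable.1 ((Lp.memLp G).smul h3)

/-- The subspace of all pairs `(u, ∇u)` in `L²(Ω) × L²(Ω)^d`. -/
def weakGradientGraph (Ω : Set (Euc d)) : Submodule ℝ (WithLp 2 (L2 Ω × L2Vec Ω)) where
  carrier := {z | IsWeakGradient Ω z.fst z.snd}
  zero_mem' := by
    intro φ h hc _
    have e1 : (fun x => (0 : L2 Ω) x • gradient φ x) =ᵐ[volume.restrict Ω] fun _ => 0 := by
      filter_upwards [Lp.coeFn_zero ℝ 2 (volume.restrict Ω)] with x hx
      rw [hx, Pi.zero_apply, zero_smul]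
    have e2 : (fun x => φ x • (0 : L2Vec Ω) x) =ᵐ[volume.restrict Ω] fun _ => 0 := by
      filter_upwards [Lp.coeFn_zero (Euc d) 2 (volume.restrict Ω)] with x hx
      rw [hx, Pi.zero_apply, smul_zero]
    change ∫ x in Ω, (0 : L2 Ω) x • gradient φ x = -∫ x in Ω, φ x • (0 : L2Vec Ω) x
    rw [integral_congr_ae e1, integral_congr_ae e2]
    simp
  add_mem' := by
    intro z w hz hw φ h hc hs
    have e1 : (fun x => (z.fst + w.fst) x • gradient φ x) =ᵐ[volume.restrict Ω]
        fun x => z.fst x • gradient φ x + w.fst x • gradient φ x := by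
      filter_upwards [Lp.coeFn_add z.fst w.fst] with x hx
      rw [hx, Pi.add_apply, add_smul]
    have e2 : (fun x => φ x • (z.snd + w.snd) x) =ᵐ[volume.restrict Ω]
        fun x => φ x • z.snd x + φ x • w.snd x := by
      filter_upwards [Lp.coeFn_add z.snd w.snd] with x hx
      rw [hx, Pi.add_apply, smul_add]
    change ∫ x in Ω, (z.fst + w.fst) x • gradient φ x = -∫ x in Ω, φ x • (z.snd + w.snd) x
    rw [integral_congr_ae e1, integral_congr_ae e2,
      integral_add (integrable_smul_gradient Ω _ h hc) (integrable_smul_gradient Ω _ h hc),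
      integral_add (integrable_smul_vec Ω _ h hc) (integrable_smul_vec Ω _ h hc),
      hz φ h hc hs, hw φ h hc hs, neg_add]
  smul_mem' := by
    intro c z hz φ h hc hs
    have e1 : (fun x => (c • z.fst) x • gradient φ x) =ᵐ[volume.restrict Ω]
        fun x => c • (z.fst x • gradient φ x) := by
      filter_upwards [Lp.coeFn_smul c z.fst] with x hx
      rw [hx, Pi.smul_apply, smul_assoc]
    have e2 : (fun x => φ x • (c • z.snd) x) =ᵐ[volume.restrict Ω]
        fun x => c • (φ x • z.snd x) := by
      filter_upwards [Lp.coeFn_smul c z.snd] with x hx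
      rw [hx, Pi.smul_apply, smul_comm]
    change ∫ x in Ω, (c • z.fst) x • gradient φ x = -∫ x in Ω, φ x • (c • z.snd) x
    rw [integral_congr_ae e1, integral_congr_ae e2, integral_smul, integral_smul,
      hz φ h hc hs, smul_neg]

/-- `V = H¹(Ω)`, realized as the space of pairs `(u, ∇u)` in `L²(Ω) × L²(Ω)^d`; its norm is
`(‖u‖² + ‖∇u‖²)^{1/2}`. -/
def H1 (Ω : Set (Euc d)) : Type := weakGradientGraph Ω

instance (Ω : Set (Euc d)) : NormedAddCommGroup (H1 Ω) :=
  inferInstanceAs (NormedAddCommGroup (weakGradientGraph Ω))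

instance (Ω : Set (Euc d)) : InnerProductSpace ℝ (H1 Ω) :=
  inferInstanceAs (InnerProductSpace ℝ (weakGradientGraph Ω))

/-- The embedding `V ⊂ H`. -/
def H1.toL2 (Ω : Set (Euc d)) : H1 Ω →L[ℝ] L2 Ω :=
  (WithLp.fstL 2 ℝ (L2 Ω) (L2Vec Ω)).comp (weakGradientGraph Ω).subtypeL

/-- The weak gradient `∇ : V → L²(Ω)^d`. -/
def H1.grad (Ω : Set (Euc d)) : H1 Ω →L[ℝ] L2Vec Ω :=
  (WithLp.sndL 2 ℝ (L2 Ω) (L2Vec Ω)).comp (weakGradientGraph Ω).subtypeL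

/-! ### Traces and the boundary space `W_Γ = H^{1/2}(Γ)` -/

/-- The pairs `(φ|_Ω, φ|_Γ)` with `φ ∈ C^∞(ℝ^d)`. -/
def smoothPairs (Ω : Set (Euc d)) : Submodule ℝ (WithLp 2 (H1 Ω × L2Bdry Ω)) where
  carrier := {p | ∃ φ : Euc d → ℝ, ContDiff ℝ ∞ φ ∧
    H1.toL2 Ω p.fst =ᵐ[volume.restrict Ω] φ ∧ p.snd =ᵐ[surf Ω] φ}
  zero_mem' := by
    refine ⟨0, contDiff_const, ?_, ?_⟩
    · change ((H1.toL2 Ω 0 : L2 Ω) : Euc d → ℝ) =ᵐ[_] _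
      rw [map_zero]
      exact Lp.coeFn_zero ℝ 2 _
    · exact Lp.coeFn_zero ℝ 2 _
  add_mem' := by
    rintro p q ⟨φ, h, h1, h2⟩ ⟨ψ, k, k1, k2⟩
    refine ⟨φ + ψ, h.add k, ?_, ?_⟩
    · change ((H1.toL2 Ω (p.fst + q.fst) : L2 Ω) : Euc d → ℝ) =ᵐ[_] _
      rw [map_add]
      exact (Lp.coeFn_add _ _).trans (h1.add k1)
    · exact (Lp.coeFn_add _ _).trans (h2.add k2)
  smul_mem' := by
    rintro c p ⟨φ, h, h1, h2⟩
    refine ⟨c • φ, h.const_smul c, ?_, ?_⟩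
    · change ((H1.toL2 Ω (c • p.fst) : L2 Ω) : Euc d → ℝ) =ᵐ[_] _
      rw [map_smul]
      exact (Lp.coeFn_smul _ _).trans (h1.const_smul c)
    · exact (Lp.coeFn_smul _ _).trans (h2.const_smul c)

/-- The graph `{(z, z|_Γ) | z ∈ V}` of the trace operator `H¹(Ω) → L²(Γ)`, i.e. of the continuous
extension of `φ|_Ω ↦ φ|_Γ`, `φ` smooth on `ℝ^d`: the closure in `V × H_Γ` of the pairs
`(φ|_Ω, φ|_Γ)`. It carries the graph norm `(‖z‖_V² + ‖z|_Γ‖_{H_Γ}²)^{1/2}`, which is equivalent to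
`‖z‖_V`. -/
def traceGraph (Ω : Set (Euc d)) : Submodule ℝ (WithLp 2 (H1 Ω × L2Bdry Ω)) :=
  (smoothPairs Ω).topologicalClosure

/-- `g ∈ L²(Γ)` is the trace of `z ∈ H¹(Ω)`. -/
def IsTrace (Ω : Set (Euc d)) (z : H1 Ω) (g : L2Bdry Ω) : Prop :=
  WithLp.toLp 2 (z, g) ∈ traceGraph Ω

/-- The space `{(z, z|_Γ) | z ∈ V}` as a type. -/
def TraceSpace (Ω : Set (Euc d)) : Type := traceGraph Ω

instance (Ω : Set (Euc d)) : NormedAddCommGroup (TraceSpace Ω) :=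
  inferInstanceAs (NormedAddCommGroup (traceGraph Ω))

instance (Ω : Set (Euc d)) : InnerProductSpace ℝ (TraceSpace Ω) :=
  inferInstanceAs (InnerProductSpace ℝ (traceGraph Ω))

/-- The map `(z, z|_Γ) ↦ z|_Γ`. -/
def traceSnd (Ω : Set (Euc d)) : TraceSpace Ω →L[ℝ] L2Bdry Ω :=
  (WithLp.sndL 2 ℝ (H1 Ω) (L2Bdry Ω)).comp (traceGraph Ω).subtypeL

/-- The elements of trace zero. -/
def traceKer (Ω : Set (Euc d)) : Submodule ℝ (TraceSpace Ω) := (traceSnd Ω).ker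

instance (Ω : Set (Euc d)) : IsClosed (traceKer Ω : Set (TraceSpace Ω)) :=
  (traceSnd Ω).isClosed_ker

/-- `W_Γ = H^{1/2}(Γ)`, the space of traces of functions in `H¹(Ω)`: functions in `H¹(Ω)` modulo
those of trace zero. The norm is the quotient norm, the infimum of the norms of all extensions. -/
def HHalf (Ω : Set (Euc d)) : Type := TraceSpace Ω ⧸ traceKer Ω

instance (Ω : Set (Euc d)) : NormedAddCommGroup (HHalf Ω) :=
  inferInstanceAs (NormedAddCommGroup (TraceSpace Ω ⧸ traceKer Ω))

instance (Ω : Set (Euc d)) : NormedSpace ℝ (HHalf Ω) :=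
  inferInstanceAs (NormedSpace ℝ (TraceSpace Ω ⧸ traceKer Ω))

/-- The embedding `W_Γ ⊂ H_Γ`. -/
def HHalf.toL2 (Ω : Set (Euc d)) : HHalf Ω →L[ℝ] L2Bdry Ω :=
  (traceKer Ω).liftQL (traceSnd Ω) le_rfl

lemma HHalf.toL2_injective (Ω : Set (Euc d)) : Function.Injective (HHalf.toL2 Ω) := by
  refine (injective_iff_map_eq_zero _).2 fun w hw => ?_
  obtain ⟨p, rfl⟩ := (traceKer Ω).mkQ_surjective w
  exact (Submodule.Quotient.mk_eq_zero _).2 hw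

/-- The image of `W_Γ` in `L²(Γ)` is exactly the set of all traces. -/
lemma HHalf.exists_toL2_eq_iff (Ω : Set (Euc d)) (g : L2Bdry Ω) :
    (∃ w : HHalf Ω, HHalf.toL2 Ω w = g) ↔ ∃ z : H1 Ω, IsTrace Ω z g := by
  constructor
  · rintro ⟨w, rfl⟩
    obtain ⟨p, rfl⟩ := (traceKer Ω).mkQ_surjective w
    exact ⟨p.1.fst, p.2⟩
  · rintro ⟨z, hz⟩
    exact ⟨(traceKer Ω).mkQ ⟨_, hz⟩, rfl⟩

/-! ### Time-dependent functions -/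

/-- Lebesgue measure on `(0,T)`. -/
abbrev timeMeasure (T : ℝ) : Measure ℝ := volume.restrict (Ioo 0 T)

/-- `g` is the derivative of `f` on `(0,T)` in the sense of vector-valued distributions. -/
def HasWeakTimeDeriv {X : Type*} [NormedAddCommGroup X] [NormedSpace ℝ X] (T : ℝ)
    (f g : ℝ → X) : Prop :=
  ∀ φ : ℝ → ℝ, ContDiff ℝ ∞ φ → HasCompactSupport φ → tsupport φ ⊆ Ioo 0 T →
    ∫ t, deriv φ t • f t ∂timeMeasure T = -∫ t, φ t • g t ∂timeMeasure T

/-- For an embedding `j : X → K` into a pivot Hilbert space `K`, identified with its dual, the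
resulting map `X → X*`, that is `⟨pivot j x, y⟩ = (j x, j y)_K`. -/
def pivot {X K : Type*} [NormedAddCommGroup X] [NormedSpace ℝ X] [NormedAddCommGroup K]
    [InnerProductSpace ℝ K] (j : X →L[ℝ] K) (x : X) : StrongDual ℝ X :=
  (innerSL ℝ (j x)).comp j

/-- `f : (0,T) → K` is a.e. equal to a continuous function `[0,T] → K` whose value at `0` is
`a`. -/
def HasInitialValue {K : Type*} [NormedAddCommGroup K] (T : ℝ) (f : ℝ → K) (a : K) : Prop :=
  ∃ g : ℝ → K, ContinuousOn g (Icc 0 T) ∧ f =ᵐ[timeMeasure T] g ∧ g 0 = a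

/-! ### Convex potentials and subdifferentials -/

/-- Convex, proper, lower semicontinuous `[0,∞]`-valued functions on `ℝ` that vanish at `0`
(properness follows from the last condition). -/
structure IsPotential (b : ℝ → ℝ≥0∞) : Prop where
  convex : ConvexOn ℝ≥0 univ b
  lsc : LowerSemicontinuous b
  zero : b 0 = 0

/-- The subdifferential `∂b(r) ⊆ ℝ` of `b : ℝ → [0,∞]`. -/
def subdiff (b : ℝ → ℝ≥0∞) (r : ℝ) : Set ℝ :=
  {ρ | b r ≠ ⊤ ∧ ∀ s : ℝ, (b r : EReal) ≤ ((ρ * (r - s) : ℝ) : EReal) + (b s : EReal)}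

/-- The subdifferential `∂F(z) ⊆ X*` of `F : X → [0,∞]`. -/
def subdiffDual {X : Type*} [NormedAddCommGroup X] [NormedSpace ℝ X] (F : X → ℝ≥0∞) (z : X) :
    Set (StrongDual ℝ X) :=
  {ρ | F z ≠ ⊤ ∧ ∀ w : X, (F z : EReal) ≤ ((ρ (z - w) : ℝ) : EReal) + (F w : EReal)}

/-- The functional on `W_Γ` induced by `b`: `z ↦ ∫_Γ b(z)`, which is `+∞` exactly when `b(z)` is
not in `L¹(Γ)`. -/
def bdryFunctional (Ω : Set (Euc d)) (b : ℝ → ℝ≥0∞) (z : HHalf Ω) : ℝ≥0∞ :=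
  ∫⁻ x, b (HHalf.toL2 Ω z x) ∂surf Ω

/-! ### The problem -/

/-- The data `f ∈ L²(0,T;H)`, `f_Γ ∈ L²(0,T;H_Γ)`, `u₀ ∈ H`, `v₀ ∈ H_Γ`. -/
structure Data (Ω : Set (Euc d)) (T : ℝ) where
  f : ℝ → L2 Ω
  fΓ : ℝ → L2Bdry Ω
  u₀ : L2 Ω
  v₀ : L2Bdry Ω
  memLp_f : MemLp f 2 (timeMeasure T)
  memLp_fΓ : MemLp fΓ 2 (timeMeasure T)

/-- A quadruplet `(u, v, ξ, ξ_Γ)` of functions of time with values in `V`, `W_Γ`, `H`, `W_Γ*`. -/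
structure Quadruplet (Ω : Set (Euc d)) where
  u : ℝ → H1 Ω
  v : ℝ → HHalf Ω
  ξ : ℝ → L2 Ω
  ξΓ : ℝ → StrongDual ℝ (HHalf Ω)

/-- The variational equation at time `t`, tested with `z ∈ V` and its trace `w ∈ W_Γ`, where `ut`
and `vt` stand for `∂ₜu` and `∂ₜv`. -/
def Equation {Ω : Set (Euc d)} {T : ℝ} (π πΓ : ℝ → ℝ) (D : Data Ω T) (S : Quadruplet Ω)
    (ut : ℝ → StrongDual ℝ (H1 Ω)) (vt : ℝ → StrongDual ℝ (HHalf Ω)) (t : ℝ)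
    (z : H1 Ω) (w : HHalf Ω) : Prop :=
  ut t z
    + (∫ x in Ω, inner ℝ (H1.grad Ω (S.u t) x) (H1.grad Ω z x))
    + (∫ x in Ω, (S.ξ t x + π (H1.toL2 Ω (S.u t) x)) * H1.toL2 Ω z x)
    + vt t w
    + (∫ x, πΓ (HHalf.toL2 Ω (S.v t) x) * HHalf.toL2 Ω w x ∂surf Ω)
    + S.ξΓ t w
  = (∫ x in Ω, D.f t x * H1.toL2 Ω z x) + (∫ x, D.fΓ t x * HHalf.toL2 Ω w x ∂surf Ω)

/-- `S = (u, v, ξ, ξ_Γ)` solves the problem with potentials `b`, `bΓ`, perturbations `π`, `πΓ` and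
data `D` on the time interval `(0,T)`. -/
structure IsSolution {Ω : Set (Euc d)} {T : ℝ} (b bΓ : ℝ → ℝ≥0∞) (π πΓ : ℝ → ℝ)
    (D : Data Ω T) (S : Quadruplet Ω) : Prop where
  memLp_u : MemLp S.u 2 (timeMeasure T)
  memLp_v : MemLp S.v 2 (timeMeasure T)
  trace : ∀ᵐ t ∂timeMeasure T, IsTrace Ω (S.u t) (HHalf.toL2 Ω (S.v t))
  memLp_ξ : MemLp S.ξ 2 (timeMeasure T)
  ξ_mem : ∀ᵐ t ∂timeMeasure T, ∀ᵐ x ∂volume.restrict Ω,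
    S.ξ t x ∈ subdiff b (H1.toL2 Ω (S.u t) x)
  memLp_ξΓ : MemLp S.ξΓ 2 (timeMeasure T)
  ξΓ_mem : ∀ᵐ t ∂timeMeasure T, S.ξΓ t ∈ subdiffDual (bdryFunctional Ω bΓ) (S.v t)
  init_u : HasInitialValue T (fun t => H1.toL2 Ω (S.u t)) D.u₀
  init_v : HasInitialValue T (fun t => HHalf.toL2 Ω (S.v t)) D.v₀
  equation : ∃ (ut : ℝ → StrongDual ℝ (H1 Ω)) (vt : ℝ → StrongDual ℝ (HHalf Ω)),
    MemLp ut 2 (timeMeasure T) ∧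
    HasWeakTimeDeriv T (fun t => pivot (H1.toL2 Ω) (S.u t)) ut ∧
    MemLp vt 2 (timeMeasure T) ∧
    HasWeakTimeDeriv T (fun t => pivot (HHalf.toL2 Ω) (S.v t)) vt ∧
    ∀ᵐ t ∂timeMeasure T, ∀ (z : H1 Ω) (w : HHalf Ω), IsTrace Ω z (HHalf.toL2 Ω w) →
      Equation π πΓ D S ut vt t z w

end AllenCahn

end

/-!
The difference of the two variational equations is tested with the difference `(u, v)` of the two
solutions, which is an admissible pair because the traces form a linear space. The subdifferentials
`β` and `∂Ψ` are monotone, so their contribution has a sign and drops out; the perturbations are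
Lipschitz continuous on `L²`, and the forcing terms are split by Young's inequality
(`dissipation_inequality`). What remains is `d/dt (‖u‖² + ‖v‖²) + 2‖∇u‖² ≤ ‖f‖² + ‖f_Γ‖² + M (‖u‖² +
‖v‖²)` with `M = 2L + 2L_Γ + 1`, and Gronwall's inequality (`energy_gronwall`) gives the estimate
with the constant `3 exp(MT)`.

The analytic point is the energy identity `‖u(t)‖² - ‖u(0)‖² = 2 ∫₀ᵗ ⟨u', u⟩` for functions
`u ∈ L²(0,T;X)` with weak derivative `u' ∈ L²(0,T;X*)` (`energy_identity`). It is obtained by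
mollification in time: the mollified functions are smooth and satisfy the identity on compact
subintervals, both factors of the duality product converge in `L²`
(`tendsto_eLpNorm_normed_convolution_sub`, which rests on the continuity of translations in `L²`),
and the boundary values converge at every time because `u` has a continuous representative with
values in the pivot space. Bochner integrals need complete spaces, whence the completeness of
`H¹(Ω)` and `H^{1/2}(Γ)`. The surface measure of the boundary has to be finite in order that
`π_Γ(v)` be square integrable (`IsSmoothBoundedDomain.isFiniteMeasure_surf`).

For uniqueness, the estimate yields that `u` and `v` coincide, hence so do their weak time
derivatives, and the two equations reduce to `∫ (ξ₁ - ξ₂) z + ⟨ξ_{Γ,1} - ξ_{Γ,2}, z|_Γ⟩ = 0` for all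
`z`. Functions `z` with compact support in `Ω` have trace zero and give `ξ₁ = ξ₂`; since every
element of `H^{1/2}(Γ)` is a trace, `ξ_{Γ,1} = ξ_{Γ,2}` follows (`eq_zero_of_forall_isTrace`).
-/

noncomputable section

namespace AllenCahn

open Filter Topology Convolution

/-! ### Mollification in time -/

lemma eLpNorm_two_sq {α E : Type*} [MeasurableSpace α] [NormedAddCommGroup E] (f : α → E)
    (μ : Measure α) : eLpNorm f 2 μ ^ 2 = ∫⁻ x, ‖f x‖ₑ ^ 2 ∂μ := by
  simpa using eLpNorm_nnreal_pow_eq_lintegral (f := f) (μ := μ) (p := 2) (by simp)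

/-- Translations act continuously on `L²(ℝ; E)`. -/
lemma tendsto_eLpNorm_translate_sub {E : Type*} [NormedAddCommGroup E] {f : ℝ → E}
    (hf : MemLp f 2 volume) :
    Tendsto (fun r : ℝ => eLpNorm (fun t => f (t - r) - f t) 2 volume) (𝓝 0) (𝓝 0) := by
  let g : ℝ → C(ℝ, ℝ) := fun r => ⟨fun t => t - r, by fun_prop⟩
  have hg : Continuous g :=
    ContinuousMap.continuous_of_continuous_uncurry _ (by
      change Continuous fun p : ℝ × ℝ => p.2 - p.1
      fun_prop)
  have hgm : ∀ r, MeasurePreserving (g r) volume volume :=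
    fun r => measurePreserving_sub_right volume r
  have h := (continuous_const (y := hf.toLp f)).compMeasurePreservingLp hg hgm (by simp)
  have h0 := (Lp.tendsto_Lp_iff_tendsto_eLpNorm' _ _).1 (h.tendsto 0)
  refine h0.congr fun r => eLpNorm_congr_ae ?_
  have e : ∀ s : ℝ, Lp.compMeasurePreserving (g s) (hgm s) (hf.toLp f) =ᵐ[volume]
      fun t => f (t - s) := fun s =>
    (Lp.coeFn_compMeasurePreserving _ (hgm s)).trans
      ((hgm s).quasiMeasurePreserving.ae_eq_comp hf.coeFn_toLp)
  filter_upwards [e r, e 0] with t h1 h2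
  rw [Pi.sub_apply, h1, h2, sub_zero]

/-- Mollification moves an `L²` function no further than the translations by vectors in the support
of the kernel do: Jensen's inequality for the kernel, and Tonelli's theorem. -/
lemma eLpNorm_normed_convolution_sub_le {E : Type*} [NormedAddCommGroup E] [NormedSpace ℝ E]
    [CompleteSpace E] (φ : ContDiffBump (0 : ℝ)) {f : ℝ → E} (hf : MemLp f 2 volume) {η : ℝ≥0∞}
    (h : ∀ r, |r| < φ.rOut → eLpNorm (fun t => f (t - r) - f t) 2 volume ≤ η) :
    eLpNorm (fun t => (φ.normed volume ⋆[ContinuousLinearMap.lsmul ℝ ℝ] f) t - f t) 2 volume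
      ≤ η := by
  set ρ := φ.normed volume with hρ
  have hρc : Continuous ρ := φ.continuous_normed
  have hρ0 : ∀ r, 0 ≤ ρ r := φ.nonneg_normed
  have hρi : Integrable ρ volume := hρc.integrable_of_hasCompactSupport φ.hasCompactSupport_normed
  have hρ1 : ∫⁻ r, ENNReal.ofReal (ρ r) = 1 := by
    rw [← ofReal_integral_eq_lintegral_ofReal hρi (ae_of_all _ hρ0), φ.integral_normed]; simp
  have hen : ∀ r, ‖ρ r‖ₑ = ENNReal.ofReal (ρ r) := fun r => Real.enorm_of_nonneg (hρ0 r)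
  -- The kernel is the density of a probability measure `P`, so that Jensen's inequality is the
  -- comparison of the norms of `L¹(P)` and `L²(P)`.
  let P : Measure ℝ := volume.withDensity fun r => ENNReal.ofReal (ρ r)
  have hP : IsProbabilityMeasure P := ⟨by simp [P, hρ1]⟩
  have hρm : Measurable fun r => ENNReal.ofReal (ρ r) := by fun_prop
  have hex := φ.hasCompactSupport_normed.convolutionExists_left (μ := volume)
    (ContinuousLinearMap.lsmul ℝ ℝ) hρc (hf.locallyIntegrable (by norm_num))
  have hsh : ∀ t : ℝ, AEStronglyMeasurable (fun r => f (t - r) - f t) volume := fun t =>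
    (hf.1.comp_quasiMeasurePreserving
      (Measure.measurePreserving_sub_left volume t).quasiMeasurePreserving).sub
      aestronglyMeasurable_const
  have key : ∀ t, ‖(ρ ⋆[ContinuousLinearMap.lsmul ℝ ℝ] f) t - f t‖ₑ ^ 2 ≤
      ∫⁻ r, ENNReal.ofReal (ρ r) * ‖f (t - r) - f t‖ₑ ^ 2 := by
    intro t
    have e1 : (ρ ⋆[ContinuousLinearMap.lsmul ℝ ℝ] f) t - f t
        = ∫ r, ρ r • (f (t - r) - f t) := by
      have : f t = ∫ r, ρ r • f t := (φ.integral_normed_smul volume (f t)).symm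
      conv_lhs => rw [this]
      rw [convolution_def, ← integral_sub (hex t) (hρi.smul_const _)]
      simp [smul_sub, hρ]
    have e2 : ‖(ρ ⋆[ContinuousLinearMap.lsmul ℝ ℝ] f) t - f t‖ₑ
        ≤ eLpNorm (fun r => f (t - r) - f t) 1 P := by
      rw [e1, eLpNorm_one_eq_lintegral_enorm]
      refine (enorm_integral_le_lintegral_enorm _).trans_eq ?_
      rw [lintegral_withDensity_eq_lintegral_mul₀ hρm.aemeasurable (hsh t).enorm]
      simp [enorm_smul, hen]
    have hsP : AEStronglyMeasurable (fun r => f (t - r) - f t) P :=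
      (hsh t).mono_ac (withDensity_absolutelyContinuous _ _)
    have e3 := e2.trans (eLpNorm_le_eLpNorm_of_exponent_le (p := 1) (q := 2) (by norm_num) hsP)
    calc _ ≤ eLpNorm (fun r => f (t - r) - f t) 2 P ^ 2 := by gcongr
      _ = _ := by
        rw [eLpNorm_two_sq,
          lintegral_withDensity_eq_lintegral_mul₀ hρm.aemeasurable ((hsh t).enorm.pow_const 2)]
        simp
  have hprod : AEMeasurable
      (fun p : ℝ × ℝ => ENNReal.ofReal (ρ p.2) * ‖f (p.1 - p.2) - f p.1‖ₑ ^ 2)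
      (volume.prod volume) := by
    have h1 : AEStronglyMeasurable (fun p : ℝ × ℝ => f (p.1 - p.2)) (volume.prod volume) :=
      hf.1.comp_quasiMeasurePreserving (quasiMeasurePreserving_sub volume volume)
    have h2 : AEStronglyMeasurable (fun p : ℝ × ℝ => f p.1) (volume.prod volume) := hf.1.comp_fst
    exact (hρm.comp measurable_snd).aemeasurable.mul ((h1.sub h2).enorm.pow_const 2)
  refine (ENNReal.pow_le_pow_left_iff two_ne_zero).1 ?_
  rw [eLpNorm_two_sq]
  calc _ ≤ ∫⁻ t, ∫⁻ r, ENNReal.ofReal (ρ r) * ‖f (t - r) - f t‖ₑ ^ 2 := lintegral_mono key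
    _ = ∫⁻ r, ∫⁻ t, ENNReal.ofReal (ρ r) * ‖f (t - r) - f t‖ₑ ^ 2 := lintegral_lintegral_swap hprod
    _ ≤ ∫⁻ r, ENNReal.ofReal (ρ r) * η ^ 2 := by
      refine lintegral_mono fun r => ?_
      simp only
      rw [lintegral_const_mul' _ _ ENNReal.ofReal_ne_top, ← eLpNorm_two_sq]
      by_cases hr : |r| < φ.rOut
      · gcongr; exact h r hr
      · have : ρ r = 0 := by
          have : r ∉ Function.support ρ := by
            rw [hρ, φ.support_normed_eq]; simpa using hr
          simpa using this
        simp [this]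
    _ = η ^ 2 := by rw [lintegral_mul_const _ hρm, hρ1, one_mul]

lemma tendsto_eLpNorm_normed_convolution_sub {E : Type*} [NormedAddCommGroup E] [NormedSpace ℝ E]
    [CompleteSpace E] {φ : ℕ → ContDiffBump (0 : ℝ)}
    (hφ : Tendsto (fun n => (φ n).rOut) atTop (𝓝 0)) {f : ℝ → E} (hf : MemLp f 2 volume) :
    Tendsto (fun n => eLpNorm (fun t =>
      ((φ n).normed volume ⋆[ContinuousLinearMap.lsmul ℝ ℝ] f) t - f t) 2 volume) atTop (𝓝 0) := by
  refine ENNReal.tendsto_nhds_zero.2 fun η hη => ?_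
  obtain ⟨δ, hδ, hδ'⟩ := Metric.eventually_nhds_iff.1
    (ENNReal.tendsto_nhds_zero.1 (tendsto_eLpNorm_translate_sub hf) η hη)
  filter_upwards [hφ.eventually (gt_mem_nhds hδ)] with n hn
  exact eLpNorm_normed_convolution_sub_le _ hf fun r hr => hδ' (by simpa using hr.trans hn)

/-! ### The energy identity -/

/-- `pivot j` as a continuous linear map. -/
def pivotL {X K : Type*} [NormedAddCommGroup X] [NormedSpace ℝ X] [NormedAddCommGroup K]
    [InnerProductSpace ℝ K] (j : X →L[ℝ] K) : X →L[ℝ] StrongDual ℝ X :=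
  ((ContinuousLinearMap.compL ℝ X K ℝ).flip j).comp
    (((innerSL ℝ : K →L⋆[ℝ] StrongDual ℝ K) : K →L[ℝ] StrongDual ℝ K).comp j)

lemma pivotL_apply {X K : Type*} [NormedAddCommGroup X] [NormedSpace ℝ X] [NormedAddCommGroup K]
    [InnerProductSpace ℝ K] (j : X →L[ℝ] K) (x : X) : pivotL j x = pivot j x := rfl

lemma memLp_indicator_time {E : Type*} [NormedAddCommGroup E] {T : ℝ} {f : ℝ → E}
    (hf : MemLp f 2 (timeMeasure T)) : MemLp ((Ioo 0 T).indicator f) 2 volume :=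
  (memLp_indicator_iff_restrict measurableSet_Ioo).2 hf

lemma intervalIntegrable_of_timeMeasure {f : ℝ → ℝ} {T t : ℝ} (hf : Integrable f (timeMeasure T))
    (ht : t ∈ Ioo 0 T) : IntervalIntegrable f volume 0 t := by
  rw [intervalIntegrable_iff_integrableOn_Ioo_of_le ht.1.le]
  exact hf.mono_measure (Measure.restrict_mono (Ioo_subset_Ioo_right ht.2.le) le_rfl)

/-- The pairing of `L²` functions with values in `X*` and `X` is continuous. -/
lemma tendsto_integral_dual_apply {α X : Type*} [MeasurableSpace α] [NormedAddCommGroup X]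
    [NormedSpace ℝ X] {μ : Measure α} {p : ℕ → α → StrongDual ℝ X} {p₀ : α → StrongDual ℝ X}
    {f : ℕ → α → X} {f₀ : α → X} (hp₀ : MemLp p₀ 2 μ) (hf₀ : MemLp f₀ 2 μ)
    (hp : ∀ n, MemLp (p n) 2 μ) (hf : ∀ n, MemLp (f n) 2 μ)
    (hpl : Tendsto (fun n => eLpNorm (fun t => p n t - p₀ t) 2 μ) atTop (𝓝 0))
    (hfl : Tendsto (fun n => eLpNorm (fun t => f n t - f₀ t) 2 μ) atTop (𝓝 0)) :
    Tendsto (fun n => ∫ t, p n t (f n t) ∂μ) atTop (𝓝 (∫ t, p₀ t (f₀ t) ∂μ)) := by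
  have h1 := (Lp.tendsto_Lp_iff_tendsto_eLpNorm'' p hp p₀ hp₀).2 hpl
  have h2 := (Lp.tendsto_Lp_iff_tendsto_eLpNorm'' f hf f₀ hf₀).2 hfl
  have e : ∀ {p : α → StrongDual ℝ X} {f : α → X} (hp : MemLp p 2 μ) (hf : MemLp f 2 μ),
      (ContinuousLinearMap.id ℝ (StrongDual ℝ X)).lpPairing μ 2 2 (hp.toLp p) (hf.toLp f)
        = ∫ t, p t (f t) ∂μ := by
    intro p f hp hf
    rw [ContinuousLinearMap.lpPairing_eq_integral]
    refine integral_congr_ae ?_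
    filter_upwards [hp.coeFn_toLp, hf.coeFn_toLp] with t h1 h2
    simp [h1, h2]
  have := (((ContinuousLinearMap.id ℝ (StrongDual ℝ X)).lpPairing μ 2 2).continuous₂.tendsto
    (hp₀.toLp p₀, hf₀.toLp f₀)).comp (h1.prodMk_nhds h2)
  simpa only [Function.comp_def, Function.uncurry, e] using this

lemma integrable_dual_apply {α X : Type*} [MeasurableSpace α] [NormedAddCommGroup X]
    [NormedSpace ℝ X] {μ : Measure α} {p : α → StrongDual ℝ X} {f : α → X} (hp : MemLp p 2 μ)
    (hf : MemLp f 2 μ) : Integrable (fun t => p t (f t)) μ := by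
  have h := (ContinuousLinearMap.id ℝ (StrongDual ℝ X)).memLp_of_bilin (p := 2) (q := 2) 1 hp hf
  exact memLp_one_iff_integrable.1 h

section Energy

variable {X K : Type*} [NormedAddCommGroup X] [NormedSpace ℝ X] [CompleteSpace X]
  [NormedAddCommGroup K] [InnerProductSpace ℝ K]

/-- Mollification commutes with the weak time derivative, away from the end points. -/
lemma pivot_deriv_convolution_eq {j : X →L[ℝ] K} {T : ℝ} {u : ℝ → X} {u' : ℝ → StrongDual ℝ X}
    (hu : MemLp u 2 (timeMeasure T)) (hd : HasWeakTimeDeriv T (fun t => pivot j (u t)) u')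
    (φ : ContDiffBump (0 : ℝ)) {t : ℝ} (ht : Metric.closedBall t φ.rOut ⊆ Ioo 0 T) :
    pivot j ((deriv (φ.normed volume) ⋆[ContinuousLinearMap.lsmul ℝ ℝ]
        (Ioo 0 T).indicator u) t)
      = (φ.normed volume ⋆[ContinuousLinearMap.lsmul ℝ ℝ] (Ioo 0 T).indicator u') t := by
  have hφ1 : ContDiff ℝ ∞ (φ.normed volume) := φ.contDiff_normed
  have hφ0 : HasCompactSupport (φ.normed volume) := φ.hasCompactSupport_normed
  have hint := hφ0.deriv.convolutionExists_left (μ := volume) (ContinuousLinearMap.lsmul ℝ ℝ)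
    (hφ1.continuous_deriv (by simp)) ((memLp_indicator_time hu).locallyIntegrable (by norm_num)) t
  have hint' := (hint.integrable_swap)
  -- The reflected kernel at `t` is an admissible test function for the weak derivative.
  let ψ : ℝ → ℝ := fun s => φ.normed volume (t - s)
  have hψ1 : ContDiff ℝ ∞ ψ := hφ1.comp (by fun_prop)
  have hψt : tsupport ψ ⊆ Metric.closedBall t φ.rOut := by
    refine closure_minimal (fun s hs => ?_) Metric.isClosed_closedBall
    have : t - s ∈ Function.support (φ.normed volume) := hs
    rw [φ.support_normed_eq, mem_ball_zero_iff] at this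
    rw [Metric.mem_closedBall, dist_comm, dist_eq_norm]
    exact this.le
  have hψ0 : HasCompactSupport ψ :=
    HasCompactSupport.of_support_subset_isCompact (isCompact_closedBall t φ.rOut)
      ((subset_tsupport ψ).trans hψt)
  have hψ' : ∀ s, deriv ψ s = - deriv (φ.normed volume) (t - s) := fun s =>
    deriv_comp_const_sub (φ.normed volume) t s
  have h := hd ψ hψ1 hψ0 (hψt.trans ht)
  rw [convolution_eq_swap, convolution_eq_swap, ← pivotL_apply,
    ← ContinuousLinearMap.integral_comp_comm _ hint']
  simp only [hψ', neg_smul, integral_neg, neg_inj] at h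
  rw [← integral_indicator measurableSet_Ioo, ← integral_indicator measurableSet_Ioo] at h
  refine Eq.trans (integral_congr_ae (ae_of_all _ fun s => ?_))
    (h.trans (integral_congr_ae (ae_of_all _ fun s => ?_)))
  · by_cases hs : s ∈ Ioo 0 T <;> simp [hs, ← pivotL_apply]
  · by_cases hs : s ∈ Ioo 0 T <;> simp [hs, ψ]

/-- The energy identity for the mollified functions. -/
lemma energy_identity_convolution {j : X →L[ℝ] K} {T : ℝ} {u : ℝ → X} {u' : ℝ → StrongDual ℝ X}
    (hu : MemLp u 2 (timeMeasure T)) (hu' : MemLp u' 2 (timeMeasure T))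
    (hd : HasWeakTimeDeriv T (fun t => pivot j (u t)) u')
    (φ : ContDiffBump (0 : ℝ)) {a b : ℝ} (hab : a ≤ b) (ha : φ.rOut < a) (hb : b < T - φ.rOut) :
    ‖j ((φ.normed volume ⋆[ContinuousLinearMap.lsmul ℝ ℝ] (Ioo 0 T).indicator u) b)‖ ^ 2
      - ‖j ((φ.normed volume ⋆[ContinuousLinearMap.lsmul ℝ ℝ] (Ioo 0 T).indicator u) a)‖ ^ 2
    = ∫ t in a..b, 2 *
      (φ.normed volume ⋆[ContinuousLinearMap.lsmul ℝ ℝ] (Ioo 0 T).indicator u') t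
      ((φ.normed volume ⋆[ContinuousLinearMap.lsmul ℝ ℝ] (Ioo 0 T).indicator u) t) := by
  have hφ1 : ContDiff ℝ ∞ (φ.normed volume) := φ.contDiff_normed
  have hφ0 : HasCompactSupport (φ.normed volume) := φ.hasCompactSupport_normed
  have hl : LocallyIntegrable ((Ioo 0 T).indicator u) volume :=
    (memLp_indicator_time hu).locallyIntegrable (by norm_num)
  have hl' : LocallyIntegrable ((Ioo 0 T).indicator u') volume :=
    (memLp_indicator_time hu').locallyIntegrable (by norm_num)
  have hc := hφ0.continuous_convolution_left (ContinuousLinearMap.lsmul ℝ ℝ) hφ1.continuous hl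
  have hc' := hφ0.continuous_convolution_left (ContinuousLinearMap.lsmul ℝ ℝ) hφ1.continuous hl'
  refine (intervalIntegral.integral_eq_sub_of_hasDerivAt (f := fun t =>
    ‖j ((φ.normed volume ⋆[ContinuousLinearMap.lsmul ℝ ℝ] (Ioo 0 T).indicator u) t)‖ ^ 2)
    (fun t ht => ?_)
    ((hc'.clm_apply hc).const_mul 2 |>.intervalIntegrable a b)).symm
  rw [uIcc_of_le hab] at ht
  have hball : Metric.closedBall t φ.rOut ⊆ Ioo 0 T := by
    rw [Real.closedBall_eq_Icc]
    exact Icc_subset_Ioo (by linarith [ht.1]) (by linarith [ht.2])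
  have h1 := j.hasFDerivAt.comp_hasDerivAt t (hφ0.hasDerivAt_convolution_left
    (ContinuousLinearMap.lsmul ℝ ℝ) (hφ1.of_le (by simp)) hl t)
  have h2 := h1.norm_sq
  rw [← pivot_deriv_convolution_eq hu hd φ hball]
  rw [real_inner_comm] at h2
  exact h2

/-- At each time, the mollified functions converge to the continuous representative `g`. -/
lemma tendsto_map_convolution [CompleteSpace K] {j : X →L[ℝ] K} {T : ℝ} {u : ℝ → X} {g : ℝ → K}
    (hu : MemLp u 2 (timeMeasure T)) (hg : ContinuousOn g (Icc 0 T))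
    (hug : (fun t => j (u t)) =ᵐ[timeMeasure T] g) {φ : ℕ → ContDiffBump (0 : ℝ)}
    (hφ : Tendsto (fun n => (φ n).rOut) atTop (𝓝 0)) {t : ℝ} (ht : t ∈ Ioo 0 T) :
    Tendsto (fun n => j (((φ n).normed volume ⋆[ContinuousLinearMap.lsmul ℝ ℝ]
      (Ioo 0 T).indicator u) t)) atTop (𝓝 (g t)) := by
  have hl : LocallyIntegrable ((Ioo 0 T).indicator u) volume :=
    (memLp_indicator_time hu).locallyIntegrable (by norm_num)
  have hug' : (fun t => j ((Ioo 0 T).indicator u t)) =ᵐ[volume] (Ioo 0 T).indicator g := by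
    filter_upwards [(ae_restrict_iff' measurableSet_Ioo).1 hug] with s hs
    by_cases h : s ∈ Ioo 0 T <;> simp [h, hs]
  have hm : AEStronglyMeasurable ((Ioo 0 T).indicator g) volume :=
    (j.continuous.comp_aestronglyMeasurable hl.aestronglyMeasurable).congr hug'
  have hgt : Tendsto ((Ioo 0 T).indicator g) (𝓝 t) (𝓝 (g t)) := by
    refine ((hg.continuousAt (Icc_mem_nhds ht.1 ht.2)).tendsto).congr' ?_
    filter_upwards [isOpen_Ioo.mem_nhds ht] with s hs
    simp [hs]
  have h := ContDiffBump.convolution_tendsto_right (μ := volume) hφ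
    (g := fun _ => (Ioo 0 T).indicator g)
    (Eventually.of_forall fun _ => hm) (hgt.comp tendsto_snd) (tendsto_const_nhds (x := t))
  refine h.congr fun n => ?_
  have hex := ((φ n).hasCompactSupport_normed (μ := volume)).convolutionExists_left (μ := volume)
    (ContinuousLinearMap.lsmul ℝ ℝ) (φ n).continuous_normed hl t
  rw [convolution_def, convolution_def, ← ContinuousLinearMap.integral_comp_comm _ hex]
  refine integral_congr_ae ?_
  filter_upwards [(Measure.measurePreserving_sub_left volume t).quasiMeasurePreserving.ae_eq_comp
    hug'] with s hs
  simp only [Function.comp_def] at hs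
  simp [← hs]

/-- The energy identity `d/dt ‖u‖² = 2⟨u', u⟩`, integrated over a compact subinterval of
`(0,T)`. -/
lemma energy_identity_interior [CompleteSpace K] {j : X →L[ℝ] K} {T : ℝ} {u : ℝ → X}
    {u' : ℝ → StrongDual ℝ X}
    {g : ℝ → K} (hu : MemLp u 2 (timeMeasure T)) (hu' : MemLp u' 2 (timeMeasure T))
    (hd : HasWeakTimeDeriv T (fun t => pivot j (u t)) u') (hg : ContinuousOn g (Icc 0 T))
    (hug : (fun t => j (u t)) =ᵐ[timeMeasure T] g) {a b : ℝ} (ha : 0 < a) (hab : a ≤ b)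
    (hb : b < T) : ‖g b‖ ^ 2 - ‖g a‖ ^ 2 = ∫ t in a..b, 2 * u' t (u t) := by
  -- The kernels have radii `1 / (n + 1)`; only that these tend to `0` matters.
  let φ : ℕ → ContDiffBump (0 : ℝ) := fun n =>
    ⟨1 / ((n : ℝ) + 1) / 2, 1 / ((n : ℝ) + 1), by positivity, half_lt_self (by positivity)⟩
  have hφ : Tendsto (fun n => (φ n).rOut) atTop (𝓝 0) := tendsto_one_div_add_atTop_nhds_zero_nat
  -- Stated for a general space, as it is applied both to `u` and to `u'`.
  have hconv : ∀ {E : Type _} [NormedAddCommGroup E] [NormedSpace ℝ E] [CompleteSpace E]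
      {f : ℝ → E} (hf : MemLp f 2 (timeMeasure T)),
      (∀ n, MemLp ((φ n).normed volume ⋆[ContinuousLinearMap.lsmul ℝ ℝ] (Ioo 0 T).indicator f) 2
        (volume.restrict (Ioc a b))) ∧
      MemLp ((Ioo 0 T).indicator f) 2 (volume.restrict (Ioc a b)) ∧
      Tendsto (fun n => eLpNorm (fun t =>
        ((φ n).normed volume ⋆[ContinuousLinearMap.lsmul ℝ ℝ] (Ioo 0 T).indicator f) t
          - (Ioo 0 T).indicator f t) 2 (volume.restrict (Ioc a b))) atTop (𝓝 0) := by
    intro E _ _ _ f hf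
    have hf' := memLp_indicator_time hf
    refine ⟨fun n => ?_, hf'.mono_measure Measure.restrict_le_self, ?_⟩
    · have hc := ((φ n).hasCompactSupport_normed (μ := volume)).continuous_convolution_left
        (μ := volume) (ContinuousLinearMap.lsmul ℝ ℝ) (φ n).continuous_normed
        (hf'.locallyIntegrable (by norm_num))
      obtain ⟨C, hC⟩ := (isCompact_Icc (a := a) (b := b)).exists_bound_of_continuousOn
        hc.continuousOn
      exact MemLp.of_bound hc.aestronglyMeasurable C
        (ae_restrict_of_forall_mem measurableSet_Ioc fun t ht => hC t (Ioc_subset_Icc_self ht))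
    · exact tendsto_of_tendsto_of_tendsto_of_le_of_le tendsto_const_nhds
        (tendsto_eLpNorm_normed_convolution_sub hφ hf') (fun _ => zero_le)
        (fun _ => eLpNorm_mono_measure _ Measure.restrict_le_self)
  obtain ⟨m1, m2, m3⟩ := hconv hu
  obtain ⟨n1, n2, n3⟩ := hconv hu'
  have hlim := tendsto_integral_dual_apply n2 m2 n1 m1 n3 m3
  have hR : ∫ t in a..b, 2 * u' t (u t) = 2 * ∫ t in Ioc a b,
      (Ioo 0 T).indicator u' t ((Ioo 0 T).indicator u t) := by
    rw [intervalIntegral.integral_const_mul, intervalIntegral.integral_of_le hab]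
    congr 1
    refine setIntegral_congr_fun measurableSet_Ioc fun t ht => ?_
    have : t ∈ Ioo 0 T := ⟨ha.trans ht.1, ht.2.trans_lt hb⟩
    simp [this]
  rw [hR]
  refine tendsto_nhds_unique (((tendsto_map_convolution hu hg hug hφ (t := b)
    ⟨ha.trans_le hab, hb⟩).norm.pow 2).sub ((tendsto_map_convolution hu hg hug hφ (t := a)
    ⟨ha, hab.trans_lt hb⟩).norm.pow 2)) ((hlim.const_mul 2).congr' ?_)
  filter_upwards [hφ.eventually (gt_mem_nhds ha), hφ.eventually (gt_mem_nhds (sub_pos.2 hb))]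
    with n h1 h2
  rw [energy_identity_convolution hu hu' hd (φ n) hab h1 (by linarith),
    intervalIntegral.integral_const_mul, intervalIntegral.integral_of_le hab]

/-- The energy identity `‖u(b)‖² - ‖u(0)‖² = 2 ∫₀ᵇ ⟨u', u⟩`, where `u(b)` is evaluated through the
continuous representative `g`. -/
theorem energy_identity [CompleteSpace K] {j : X →L[ℝ] K} {T : ℝ} {u : ℝ → X}
    {u' : ℝ → StrongDual ℝ X}
    {g : ℝ → K} (hu : MemLp u 2 (timeMeasure T)) (hu' : MemLp u' 2 (timeMeasure T))
    (hd : HasWeakTimeDeriv T (fun t => pivot j (u t)) u') (hg : ContinuousOn g (Icc 0 T))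
    (hug : (fun t => j (u t)) =ᵐ[timeMeasure T] g) {b : ℝ} (hb0 : 0 < b) (hb : b < T) :
    ‖g b‖ ^ 2 - ‖g 0‖ ^ 2 = ∫ t in (0 : ℝ)..b, 2 * u' t (u t) := by
  have hi : IntervalIntegrable (fun t => 2 * u' t (u t)) volume 0 b :=
    intervalIntegrable_of_timeMeasure ((integrable_dual_apply hu' hu).const_mul 2) ⟨hb0, hb⟩
  have h1 : Tendsto (fun a => ∫ t in a..b, 2 * u' t (u t)) (𝓝[>] 0)
      (𝓝 (∫ t in (0 : ℝ)..b, 2 * u' t (u t))) := by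
    have hc : ContinuousOn (fun a => ∫ t in a..b, 2 * u' t (u t)) (uIcc 0 b) :=
      intervalIntegral.continuousOn_primitive_interval_left
        (by rw [uIcc_comm]; exact ((intervalIntegrable_iff' enorm_ne_top).1 hi.symm))
    rw [uIcc_of_le hb0.le] at hc
    exact (hc 0 ⟨le_rfl, hb0.le⟩).mono_of_mem_nhdsWithin
      (mem_of_superset (Ioo_mem_nhdsGT hb0) Ioo_subset_Icc_self)
  have h2 : Tendsto (fun a => ‖g b‖ ^ 2 - ‖g a‖ ^ 2) (𝓝[>] 0) (𝓝 (‖g b‖ ^ 2 - ‖g 0‖ ^ 2)) := by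
    have hT : 0 < T := hb0.trans hb
    have : Tendsto g (𝓝[>] 0) (𝓝 (g 0)) := (hg 0 ⟨le_rfl, hT.le⟩).mono_of_mem_nhdsWithin
      (mem_of_superset (Ioo_mem_nhdsGT hT) Ioo_subset_Icc_self)
    exact tendsto_const_nhds.sub (this.norm.pow 2)
  refine tendsto_nhds_unique (h2.congr' ?_) h1
  filter_upwards [Ioo_mem_nhdsGT hb0] with a ha
  exact energy_identity_interior hu hu' hd hg hug ha.1 ha.2.le hb

end Energy

variable {d : ℕ}

/-! ### Finiteness of the measures -/

lemma IsSmoothBoundedDomain.isFiniteMeasure_volume {Ω : Set (Euc d)}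
    (hΩ : IsSmoothBoundedDomain Ω) : IsFiniteMeasure (volume.restrict Ω) :=
  isFiniteMeasure_restrict.2 hΩ.isBounded.measure_lt_top.ne

/-- A hyperplane is a `(d-1)`-dimensional inner product space, on which the `(d-1)`-dimensional
Hausdorff measure is a Haar measure and so is finite on bounded sets. -/
lemma hausdorffMeasure_hyperplane_inter_closedBall_lt_top (hd : 1 ≤ d) (i : Fin d) (R : ℝ) :
    Measure.hausdorffMeasure ((d - 1 : ℕ) : ℝ) ({y : Euc d | y i = 0} ∩ Metric.closedBall 0 R)
      < ⊤ := by
  let H : Submodule ℝ (Euc d) := (Submodule.span ℝ {EuclideanSpace.single i (1 : ℝ)})ᗮ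
  have hfact : Fact (Module.finrank ℝ (Euc d) = (d - 1) + 1) := ⟨by simp; omega⟩
  have hH : Module.finrank ℝ H = d - 1 := Submodule.finrank_orthogonal_span_singleton (by simp)
  have hmem : ∀ y : Euc d, y i = 0 → y ∈ H := fun y hy => by
    rw [Submodule.mem_orthogonal_singleton_iff_inner_right]
    simp [EuclideanSpace.inner_single_left, hy]
  have hsub : {y : Euc d | y i = 0} ∩ Metric.closedBall 0 R
      ⊆ Subtype.val '' (Metric.closedBall (0 : H) R) := by
    rintro y ⟨h1, h2⟩
    exact ⟨⟨y, hmem y h1⟩, by simpa using h2, rfl⟩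
  refine (measure_mono hsub).trans_lt ?_
  rw [isometry_subtype_coe.hausdorffMeasure_image (Or.inl (Nat.cast_nonneg _)), ← hH]
  exact (isCompact_closedBall (0 : H) R).measure_lt_top

/-- The boundary has finite surface measure: it is compact, and locally the Lipschitz image of a
bounded part of a hyperplane. -/
lemma IsSmoothBoundedDomain.isFiniteMeasure_surf (hd : 1 ≤ d) {Ω : Set (Euc d)}
    (hΩ : IsSmoothBoundedDomain Ω) : IsFiniteMeasure (surf Ω) := by
  have hc : IsCompact (frontier Ω) := Metric.isCompact_of_isClosed_isBounded isClosed_frontier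
    (hΩ.isBounded.closure.subset frontier_subset_closure)
  refine isFiniteMeasure_restrict.2 (ne_of_lt ?_)
  refine hc.measure_lt_top_of_nhdsWithin fun x hx => ?_
  obtain ⟨Φ, hxs, -, hsymm, i, hi⟩ := hΩ.smooth_boundary x hx
  have hy := Φ.map_source hxs
  obtain ⟨K, t, ht, hK⟩ := ((hsymm.of_le (m := 1) (by simp)).contDiffAt
    (Φ.open_target.mem_nhds hy)).exists_lipschitzOnWith
  let t' := t ∩ (Φ.target ∩ Metric.closedBall 0 (‖Φ x‖ + 1))
  have ht' : t' ∈ 𝓝 (Φ x) := inter_mem ht (inter_mem (Φ.open_target.mem_nhds hy)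
    (Metric.closedBall_mem_nhds_of_mem (by simp)))
  have hN : Φ.source ∩ Φ ⁻¹' t' ∈ 𝓝 x :=
    inter_mem (Φ.open_source.mem_nhds hxs) ((Φ.continuousAt hxs).preimage_mem_nhds ht')
  refine ⟨(Φ.source ∩ Φ ⁻¹' t') ∩ frontier Ω,
    inter_mem (mem_nhdsWithin_of_mem_nhds hN) self_mem_nhdsWithin, ?_⟩
  have hsub : (Φ.source ∩ Φ ⁻¹' t') ∩ frontier Ω
      ⊆ Φ.symm '' (t' ∩ {y | y i = 0}) := by
    rintro z ⟨⟨h1, h2⟩, h3⟩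
    refine ⟨Φ z, ⟨h2, ?_⟩, Φ.left_inv h1⟩
    have h4 : Φ z ∈ frontier {y : Euc d | 0 < y i} := (hi.frontier h1).2 h3
    exact (frontier_lt_subset_eq continuous_const (by fun_prop) h4).symm
  have hfin : Measure.hausdorffMeasure ((d - 1 : ℕ) : ℝ) (Φ.symm '' (t' ∩ {y | y i = 0})) < ⊤ := by
    refine ((hK.mono (fun z hz => hz.1.1)).hausdorffMeasure_image_le
      (Nat.cast_nonneg _)).trans_lt ?_
    refine ENNReal.mul_lt_top (ENNReal.rpow_lt_top_of_nonneg (by positivity) (by simp)) ?_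
    have hsub' : t' ∩ {y | y i = 0} ⊆
        {y : Euc d | y i = 0} ∩ Metric.closedBall 0 (‖Φ x‖ + 1) := fun z hz => ⟨hz.2, hz.1.2.2⟩
    exact (measure_mono hsub').trans_lt
      (hausdorffMeasure_hyperplane_inter_closedBall_lt_top hd i _)
  refine (measure_mono hsub).trans_lt ?_
  rw [Measure.euclideanHausdorffMeasure_def, Measure.smul_apply]
  exact ENNReal.mul_lt_top ENNReal.coe_lt_top hfin

/-! ### The function spaces -/

lemma continuous_gradient {φ : Euc d → ℝ} (h : ContDiff ℝ ∞ φ) : Continuous (gradient φ) :=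
  (InnerProductSpace.toDual ℝ (Euc d)).symm.continuous.comp (h.continuous_fderiv (by simp))

lemma hasCompactSupport_gradient {φ : Euc d → ℝ} (hc : HasCompactSupport φ) :
    HasCompactSupport (gradient φ) :=
  (hc.fderiv (𝕜 := ℝ)).comp_left (g := (InnerProductSpace.toDual ℝ (Euc d)).symm) (map_zero _)

lemma memLp_gradient (Ω : Set (Euc d)) {φ : Euc d → ℝ} (h : ContDiff ℝ ∞ φ)
    (hc : HasCompactSupport φ) : MemLp (gradient φ) 2 (volume.restrict Ω) :=
  (continuous_gradient h).memLp_of_hasCompactSupport (hasCompactSupport_gradient hc)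

/-- The weak gradient is a closed operator, as each test function gives a closed condition. -/
lemma isClosed_weakGradientGraph (Ω : Set (Euc d)) :
    IsClosed (weakGradientGraph Ω : Set (WithLp 2 (L2 Ω × L2Vec Ω))) := by
  have e : (weakGradientGraph Ω : Set (WithLp 2 (L2 Ω × L2Vec Ω))) =
      ⋂ (φ : Euc d → ℝ) (_ : ContDiff ℝ ∞ φ) (_ : HasCompactSupport φ) (_ : tsupport φ ⊆ Ω),
        {z | ∫ x in Ω, z.fst x • gradient φ x = -∫ x in Ω, φ x • z.snd x} := by
    ext z
    simp only [mem_iInter]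
    rfl
  rw [e]
  refine isClosed_iInter fun φ => isClosed_iInter fun h => isClosed_iInter fun hc =>
    isClosed_iInter fun _ => ?_
  have h1 := memLp_gradient Ω h hc
  have h2 : MemLp φ 2 (volume.restrict Ω) := h.continuous.memLp_of_hasCompactSupport hc
  let B : ℝ →L[ℝ] Euc d →L[ℝ] Euc d := ContinuousLinearMap.lsmul ℝ ℝ
  have e1 : ∀ u : L2 Ω, ∫ x in Ω, u x • gradient φ x
      = B.lpPairing (volume.restrict Ω) 2 2 u (h1.toLp _) := by
    intro u
    rw [ContinuousLinearMap.lpPairing_eq_integral]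
    refine integral_congr_ae ?_
    filter_upwards [h1.coeFn_toLp] with x hx
    simp [hx, B]
  have e2 : ∀ G : L2Vec Ω, ∫ x in Ω, φ x • G x
      = B.lpPairing (volume.restrict Ω) 2 2 (h2.toLp _) G := by
    intro G
    rw [ContinuousLinearMap.lpPairing_eq_integral]
    refine integral_congr_ae ?_
    filter_upwards [h2.coeFn_toLp] with x hx
    simp [hx, B]
  simp only [e1, e2]
  have c1 : Continuous fun z : WithLp 2 (L2 Ω × L2Vec Ω) => z.fst :=
    (WithLp.fstL 2 ℝ (L2 Ω) (L2Vec Ω)).continuous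
  have c2 : Continuous fun z : WithLp 2 (L2 Ω × L2Vec Ω) => z.snd :=
    (WithLp.sndL 2 ℝ (L2 Ω) (L2Vec Ω)).continuous
  exact isClosed_eq (((B.lpPairing (volume.restrict Ω) 2 2).continuous.comp c1).clm_apply
    continuous_const) (((B.lpPairing (volume.restrict Ω) 2 2 (h2.toLp _)).continuous.comp c2).neg)

instance (Ω : Set (Euc d)) : CompleteSpace (H1 Ω) :=
  (isClosed_weakGradientGraph Ω).completeSpace_coe

instance (Ω : Set (Euc d)) : CompleteSpace (TraceSpace Ω) :=
  (smoothPairs Ω).isClosed_topologicalClosure.completeSpace_coe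

instance (Ω : Set (Euc d)) : CompleteSpace (HHalf Ω) :=
  inferInstanceAs (CompleteSpace (TraceSpace Ω ⧸ traceKer Ω))

lemma H1.ext_of_toL2_grad {Ω : Set (Euc d)} {z w : H1 Ω} (h1 : H1.toL2 Ω z = H1.toL2 Ω w)
    (h2 : H1.grad Ω z = H1.grad Ω w) : z = w :=
  Subtype.ext (WithLp.ofLp_injective 2 (Prod.ext h1 h2))

lemma IsTrace.sub {Ω : Set (Euc d)} {z₁ z₂ : H1 Ω} {g₁ g₂ : L2Bdry Ω} (h₁ : IsTrace Ω z₁ g₁)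
    (h₂ : IsTrace Ω z₂ g₂) : IsTrace Ω (z₁ - z₂) (g₁ - g₂) :=
  (traceGraph Ω).sub_mem h₁ h₂

/-- Integration by parts: the classical gradient of a smooth function is its weak gradient. No
boundary term arises, as test functions have compact support in `Ω`. -/
lemma isWeakGradient_of_contDiff {Ω : Set (Euc d)} {φ : Euc d → ℝ} (h : ContDiff ℝ ∞ φ) :
    IsWeakGradient Ω φ (gradient φ) := by
  intro ψ k kc ks
  have hd : ∀ {f : Euc d → ℝ}, ContDiff ℝ ∞ f → Differentiable ℝ f := fun hf =>
    hf.differentiable (by simp)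
  have i1 : Integrable (fun x => φ x • gradient ψ x) :=
    (h.continuous.smul (continuous_gradient k)).integrable_of_hasCompactSupport
      (hasCompactSupport_gradient kc).smul_left
  have i2 : Integrable (fun x => ψ x • gradient φ x) :=
    (k.continuous.smul (continuous_gradient h)).integrable_of_hasCompactSupport kc.smul_right
  have hsupp : ∀ x ∉ Ω, ψ x = 0 := fun x hx =>
    image_eq_zero_of_notMem_tsupport fun hx' => hx (ks hx')
  have hsupp' : ∀ x ∉ Ω, gradient ψ x = 0 := fun x hx => by
    have : x ∉ tsupport (fderiv ℝ ψ) := fun hx' => hx (ks (tsupport_fderiv_subset ℝ hx'))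
    simp [gradient, image_eq_zero_of_notMem_tsupport this]
  -- Both integrands vanish outside `Ω`, so the integrals may be taken over the whole space.
  rw [setIntegral_eq_integral_of_forall_compl_eq_zero (fun x hx => by simp [hsupp' x hx]),
    setIntegral_eq_integral_of_forall_compl_eq_zero (fun x hx => by simp [hsupp x hx])]
  refine ext_inner_left ℝ fun v => ?_
  rw [inner_neg_right, ← integral_inner i1, ← integral_inner i2]
  have hin : ∀ {f : Euc d → ℝ} (x : Euc d), inner ℝ v (gradient f x) = fderiv ℝ f x v := by
    intro f x
    rw [real_inner_comm, inner_gradient_left]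
  simp only [inner_smul_right, hin]
  have c1 : Continuous fun x => fderiv ℝ φ x v := (h.continuous_fderiv (by simp)).clm_apply
    continuous_const
  have c2 : Continuous fun x => fderiv ℝ ψ x v := (k.continuous_fderiv (by simp)).clm_apply
    continuous_const
  have kv : HasCompactSupport fun x => fderiv ℝ ψ x v := kc.fderiv_apply (𝕜 := ℝ) v
  rw [integral_mul_fderiv_eq_neg_fderiv_mul_of_integrable
    ((c1.mul k.continuous).integrable_of_hasCompactSupport kc.mul_left)
    ((h.continuous.mul c2).integrable_of_hasCompactSupport kv.mul_left)
    ((h.continuous.mul k.continuous).integrable_of_hasCompactSupport kc.mul_left)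
    (fun x _ => hd h x) (fun x _ => hd k x)]
  simp only [mul_comm]

/-- A test function supported in `Ω` defines an element of `H¹(Ω)` of trace zero. -/
lemma exists_H1_isTrace_zero {Ω : Set (Euc d)} (hΩ : IsOpen Ω) {φ : Euc d → ℝ}
    (h : ContDiff ℝ ∞ φ) (hc : HasCompactSupport φ) (hs : tsupport φ ⊆ Ω) :
    ∃ z : H1 Ω, H1.toL2 Ω z =ᵐ[volume.restrict Ω] φ ∧ IsTrace Ω z 0 := by
  have h1 := memLp_gradient Ω h hc
  have h2 : MemLp φ 2 (volume.restrict Ω) := h.continuous.memLp_of_hasCompactSupport hc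
  have hmem : WithLp.toLp 2 (h2.toLp φ, h1.toLp (gradient φ)) ∈ weakGradientGraph Ω := by
    intro ψ k kc ks
    refine Eq.trans (integral_congr_ae ?_) ((isWeakGradient_of_contDiff h ψ k kc ks).trans
      (congrArg _ (integral_congr_ae ?_)))
    · filter_upwards [h2.coeFn_toLp] with x hx
      exact congrArg (· • gradient ψ x) hx
    · filter_upwards [h1.coeFn_toLp] with x hx
      exact congrArg (ψ x • ·) hx.symm
  refine ⟨⟨_, hmem⟩, h2.coeFn_toLp, subset_closure ⟨φ, h, h2.coeFn_toLp, ?_⟩⟩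
  have e : φ =ᵐ[surf Ω] 0 := by
    refine ae_restrict_of_forall_mem isClosed_frontier.measurableSet fun x hx => ?_
    refine image_eq_zero_of_notMem_tsupport fun hx' => ?_
    rw [hΩ.frontier_eq] at hx
    exact hx.2 (hs hx')
  exact (Lp.coeFn_zero ℝ 2 _).trans e.symm

lemma HHalf.exists_isTrace {Ω : Set (Euc d)} (w : HHalf Ω) :
    ∃ z : H1 Ω, IsTrace Ω z (HHalf.toL2 Ω w) :=
  (HHalf.exists_toL2_eq_iff Ω _).1 ⟨w, rfl⟩

/-! ### Monotonicity of subdifferentials -/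

/-- The two subgradient inequalities for a pair of points can be added, since both values are
finite. -/
lemma nonneg_of_ereal_le {F G : ℝ≥0∞} (hF : F ≠ ⊤) (hG : G ≠ ⊤) {p q : ℝ}
    (h1 : (F : EReal) ≤ ((p : ℝ) : EReal) + (G : EReal))
    (h2 : (G : EReal) ≤ ((q : ℝ) : EReal) + (F : EReal)) : 0 ≤ p + q := by
  lift F to ℝ≥0 using hF
  lift G to ℝ≥0 using hG
  rw [EReal.coe_nnreal_eq_coe_real, EReal.coe_nnreal_eq_coe_real, ← EReal.coe_add,
    EReal.coe_le_coe_iff] at h1 h2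
  linarith

lemma subdiff_monotone {b : ℝ → ℝ≥0∞} {r₁ r₂ ρ₁ ρ₂ : ℝ} (h₁ : ρ₁ ∈ subdiff b r₁)
    (h₂ : ρ₂ ∈ subdiff b r₂) : 0 ≤ (ρ₁ - ρ₂) * (r₁ - r₂) := by
  have := nonneg_of_ereal_le h₁.1 h₂.1 (h₁.2 r₂) (h₂.2 r₁)
  linarith

lemma subdiffDual_monotone {X : Type*} [NormedAddCommGroup X] [NormedSpace ℝ X] {F : X → ℝ≥0∞}
    {z₁ z₂ : X} {ρ₁ ρ₂ : StrongDual ℝ X} (h₁ : ρ₁ ∈ subdiffDual F z₁)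
    (h₂ : ρ₂ ∈ subdiffDual F z₂) : 0 ≤ (ρ₁ - ρ₂) (z₁ - z₂) := by
  have := nonneg_of_ereal_le h₁.1 h₂.1 (h₁.2 z₂) (h₂.2 z₁)
  rw [← neg_sub z₁ z₂, map_neg] at this
  simpa [sub_eq_add_neg] using this

/-! ### Gronwall's inequality and Nemytskii operators -/

/-- Gronwall's inequality in integral form, with the bound at the final time. -/
lemma gronwall_integral {y : ℝ → ℝ} {A M T : ℝ} (hT : 0 < T) (hA : 0 ≤ A) (hM : 0 ≤ M)
    (hy : ContinuousOn y (Icc 0 T))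
    (h : ∀ t ∈ Ioo 0 T, y t ≤ A + M * ∫ s in (0 : ℝ)..t, y s) :
    ∀ t ∈ Icc 0 T, y t ≤ A * Real.exp (M * T) := by
  have hi : IntegrableOn y (uIcc 0 T) := by
    rw [uIcc_of_le hT.le]; exact hy.integrableOn_compact isCompact_Icc
  -- The majorant of `y`, multiplied by `exp (-Mt)`, is nonincreasing.
  let Z : ℝ → ℝ := fun t => (A + M * ∫ s in (0 : ℝ)..t, y s) * Real.exp (-(M * t))
  have hZc : ContinuousOn Z (Icc 0 T) := by
    have h1 := intervalIntegral.continuousOn_primitive_interval hi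
    rw [uIcc_of_le hT.le] at h1
    exact (continuousOn_const.add (h1.const_mul M)).mul (by fun_prop)
  have hZd : ∀ t ∈ Ioo 0 T, HasDerivAt Z ((M * y t) * Real.exp (-(M * t))
      + (A + M * ∫ s in (0 : ℝ)..t, y s) * (Real.exp (-(M * t)) * -M)) t := by
    intro t ht
    have h1 : HasDerivAt (fun t => ∫ s in (0 : ℝ)..t, y s) (y t) t := by
      refine intervalIntegral.integral_hasDerivAt_right ?_ ?_
        (hy.continuousAt (Icc_mem_nhds ht.1 ht.2))
      · rw [intervalIntegrable_iff' enorm_ne_top]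
        exact hi.mono_set (uIcc_subset_uIcc_left (by
          rw [uIcc_of_le hT.le]; exact ⟨ht.1.le, ht.2.le⟩))
      · exact (hy.mono Ioo_subset_Icc_self).stronglyMeasurableAtFilter isOpen_Ioo t ht
    have h2 : HasDerivAt (fun t => Real.exp (-(M * t))) (Real.exp (-(M * t)) * -M) t := by
      simpa using (((hasDerivAt_id t).const_mul M).neg).exp
    exact ((h1.const_mul M).const_add A).mul h2
  have hZa : AntitoneOn Z (Icc 0 T) := by
    refine antitoneOn_of_deriv_nonpos (convex_Icc 0 T) hZc ?_ ?_
    · rw [interior_Icc]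
      exact fun t ht => (hZd t ht).differentiableAt.differentiableWithinAt
    · rw [interior_Icc]
      intro t ht
      rw [(hZd t ht).deriv]
      have := mul_nonneg (mul_nonneg hM (sub_nonneg.2 (h t ht))) (Real.exp_pos (-(M * t))).le
      linarith
  have hIoo : ∀ t ∈ Ioo 0 T, y t ≤ A * Real.exp (M * T) := by
    intro t ht
    have h1 : Z t ≤ A := by
      simpa [Z] using hZa ⟨le_rfl, hT.le⟩ (Ioo_subset_Icc_self ht) ht.1.le
    have h2 : A + M * (∫ s in (0 : ℝ)..t, y s) = Z t * Real.exp (M * t) := by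
      simp only [Z]
      rw [mul_assoc, ← Real.exp_add, neg_add_cancel, Real.exp_zero, mul_one]
    calc y t ≤ Z t * Real.exp (M * t) := (h t ht).trans_eq h2
      _ ≤ A * Real.exp (M * t) := by gcongr
      _ ≤ A * Real.exp (M * T) := by gcongr; exact ht.2.le
  intro t ht
  have hcl : closure (Ioo 0 T) = Icc 0 T := closure_Ioo hT.ne
  rw [← hcl] at ht hy
  exact ContinuousWithinAt.closure_le ht ((hy t ht).mono subset_closure)
    continuousWithinAt_const hIoo

/-- A Lipschitz function acts on `L²` of a finite measure by superposition, with the same Lipschitz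
constant. -/
lemma exists_nemytskii {α : Type*} [MeasurableSpace α] (μ : Measure α) [IsFiniteMeasure μ]
    {L : ℝ≥0} {π : ℝ → ℝ} (hπ : LipschitzWith L π) :
    ∃ N : Lp ℝ 2 μ → Lp ℝ 2 μ, (∀ f, N f =ᵐ[μ] fun x => π (f x)) ∧ LipschitzWith L N := by
  have hm : ∀ f : Lp ℝ 2 μ, MemLp (fun x => π (f x)) 2 μ := by
    intro f
    have h0 : LipschitzWith L fun r => π r - π 0 := by
      simpa using hπ.sub (LipschitzWith.const (π 0))
    have h1 : MemLp (fun x => π (f x) - π 0) 2 μ :=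
      h0.comp_memLp (sub_self _) (Lp.memLp f)
    have h2 := h1.add (memLp_const (π 0))
    exact h2.ae_eq (ae_of_all _ fun x => sub_add_cancel _ _)
  refine ⟨fun f => (hm f).toLp _, fun f => (hm f).coeFn_toLp, ?_⟩
  refine LipschitzWith.of_dist_le_mul fun f g => ?_
  rw [dist_eq_norm, dist_eq_norm]
  refine Lp.norm_le_mul_norm_of_ae_le_mul ?_
  filter_upwards [(hm f).coeFn_toLp, (hm g).coeFn_toLp, Lp.coeFn_sub f g,
    Lp.coeFn_sub ((hm f).toLp _) ((hm g).toLp _)] with x h1 h2 h3 h4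
  rw [h3, h4, Pi.sub_apply, Pi.sub_apply, h1, h2]
  exact hπ.norm_sub_le _ _

lemma integral_mul_eq_inner {α : Type*} [MeasurableSpace α] {μ : Measure α} (f g : Lp ℝ 2 μ) :
    ∫ x, f x * g x ∂μ = inner ℝ f g := by
  rw [L2.inner_def]
  simp [mul_comm]

/-! ### Weak time derivatives -/

section WeakDeriv

variable {X K : Type*} [NormedAddCommGroup X] [NormedSpace ℝ X]
  [NormedAddCommGroup K] [InnerProductSpace ℝ K]

lemma integrable_smul_of_memLp_two {T : ℝ} {f : ℝ → X} (hf : MemLp f 2 (timeMeasure T))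
    {φ : ℝ → ℝ} (h : Continuous φ) (hc : HasCompactSupport φ) :
    Integrable (fun t => φ t • f t) (timeMeasure T) :=
  memLp_one_iff_integrable.1 (hf.smul (h.memLp_of_hasCompactSupport hc (p := 2)))

lemma memLp_pivot {j : X →L[ℝ] K} {T : ℝ} {u : ℝ → X} (hu : MemLp u 2 (timeMeasure T)) :
    MemLp (fun t => pivot j (u t)) 2 (timeMeasure T) :=
  (pivotL j).comp_memLp' hu

lemma HasWeakTimeDeriv.sub {T : ℝ} {f₁ f₂ g₁ g₂ : ℝ → X}
    (h₁ : HasWeakTimeDeriv T f₁ g₁) (h₂ : HasWeakTimeDeriv T f₂ g₂)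
    (hf₁ : MemLp f₁ 2 (timeMeasure T)) (hf₂ : MemLp f₂ 2 (timeMeasure T))
    (hg₁ : MemLp g₁ 2 (timeMeasure T)) (hg₂ : MemLp g₂ 2 (timeMeasure T)) :
    HasWeakTimeDeriv T (fun t => f₁ t - f₂ t) (fun t => g₁ t - g₂ t) := by
  intro φ h hc hs
  have hd := h.continuous_deriv (by simp)
  simp only [smul_sub]
  rw [integral_sub (integrable_smul_of_memLp_two hf₁ hd hc.deriv)
      (integrable_smul_of_memLp_two hf₂ hd hc.deriv),
    integral_sub (integrable_smul_of_memLp_two hg₁ h.continuous hc)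
      (integrable_smul_of_memLp_two hg₂ h.continuous hc), h₁ φ h hc hs, h₂ φ h hc hs]
  abel

/-- Weak time derivatives are unique, by the fundamental lemma of the calculus of variations. -/
lemma HasWeakTimeDeriv.ae_eq [CompleteSpace X] {T : ℝ} {f₁ f₂ g₁ g₂ : ℝ → X}
    (h₁ : HasWeakTimeDeriv T f₁ g₁) (h₂ : HasWeakTimeDeriv T f₂ g₂)
    (hf : f₁ =ᵐ[timeMeasure T] f₂)
    (hg₁ : MemLp g₁ 2 (timeMeasure T)) (hg₂ : MemLp g₂ 2 (timeMeasure T)) :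
    g₁ =ᵐ[timeMeasure T] g₂ := by
  have hli : LocallyIntegrableOn (fun t => g₁ t - g₂ t) (Ioo 0 T) volume :=
    IntegrableOn.locallyIntegrableOn ((hg₁.sub hg₂).integrable (by norm_num))
  have := isOpen_Ioo.ae_eq_zero_of_integral_contDiff_smul_eq_zero hli fun φ h hc hs => by
    rw [← setIntegral_eq_integral_of_forall_compl_eq_zero (s := Ioo 0 T) (fun t ht => by
      rw [image_eq_zero_of_notMem_tsupport fun h' => ht (hs h'), zero_smul])]
    simp only [smul_sub]
    rw [integral_sub (integrable_smul_of_memLp_two hg₁ h.continuous hc)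
      (integrable_smul_of_memLp_two hg₂ h.continuous hc), sub_eq_zero, ← neg_inj,
      ← h₁ φ h hc hs, ← h₂ φ h hc hs]
    refine integral_congr_ae ?_
    filter_upwards [hf] with t ht
    rw [ht]
  filter_upwards [(ae_restrict_iff' measurableSet_Ioo).2 this] with t ht
  exact sub_eq_zero.1 ht

end WeakDeriv

/-! ### The difference of two solutions -/

/-- The variational equation in terms of inner products; `N` and `NΓ` are the superposition
operators of `π` and `πΓ`. -/
lemma Equation.inner_form {Ω : Set (Euc d)} {T : ℝ} {π πΓ : ℝ → ℝ} {D : Data Ω T}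
    {S : Quadruplet Ω} {ut : ℝ → StrongDual ℝ (H1 Ω)} {vt : ℝ → StrongDual ℝ (HHalf Ω)} {t : ℝ}
    {z : H1 Ω} {w : HHalf Ω} (h : Equation π πΓ D S ut vt t z w)
    {N : L2 Ω → L2 Ω} (hN : ∀ f, N f =ᵐ[volume.restrict Ω] fun x => π (f x))
    {NΓ : L2Bdry Ω → L2Bdry Ω} (hNΓ : ∀ f, NΓ f =ᵐ[surf Ω] fun x => πΓ (f x)) :
    ut t z + inner ℝ (H1.grad Ω (S.u t)) (H1.grad Ω z)
      + inner ℝ (S.ξ t + N (H1.toL2 Ω (S.u t))) (H1.toL2 Ω z)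
      + vt t w + inner ℝ (NΓ (HHalf.toL2 Ω (S.v t))) (HHalf.toL2 Ω w) + S.ξΓ t w
    = inner ℝ (D.f t) (H1.toL2 Ω z) + inner ℝ (D.fΓ t) (HHalf.toL2 Ω w) := by
  have e1 : ∫ x in Ω, (S.ξ t x + π (H1.toL2 Ω (S.u t) x)) * H1.toL2 Ω z x
      = inner ℝ (S.ξ t + N (H1.toL2 Ω (S.u t))) (H1.toL2 Ω z) := by
    rw [← integral_mul_eq_inner]
    refine integral_congr_ae ?_
    filter_upwards [hN (H1.toL2 Ω (S.u t)), Lp.coeFn_add (S.ξ t) (N (H1.toL2 Ω (S.u t)))]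
      with x h1 h2
    rw [h2, Pi.add_apply, h1]
  have e2 : ∫ x, πΓ (HHalf.toL2 Ω (S.v t) x) * HHalf.toL2 Ω w x ∂surf Ω
      = inner ℝ (NΓ (HHalf.toL2 Ω (S.v t))) (HHalf.toL2 Ω w) := by
    rw [← integral_mul_eq_inner]
    refine integral_congr_ae ?_
    filter_upwards [hNΓ (HHalf.toL2 Ω (S.v t))] with x h1
    rw [h1]
  unfold Equation at h
  rwa [e1, e2, integral_mul_eq_inner, integral_mul_eq_inner, ← L2.inner_def] at h

/-- The subdifferential of a potential induces a monotone operator in `L²(Ω)`. -/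
lemma inner_sub_nonneg_of_mem_subdiff {Ω : Set (Euc d)} {b : ℝ → ℝ≥0∞} {ξ₁ ξ₂ u₁ u₂ : L2 Ω}
    (h₁ : ∀ᵐ x ∂volume.restrict Ω, ξ₁ x ∈ subdiff b (u₁ x))
    (h₂ : ∀ᵐ x ∂volume.restrict Ω, ξ₂ x ∈ subdiff b (u₂ x)) :
    0 ≤ inner ℝ (ξ₁ - ξ₂) (u₁ - u₂) := by
  rw [← integral_mul_eq_inner]
  refine integral_nonneg_of_ae ?_
  filter_upwards [h₁, h₂, Lp.coeFn_sub ξ₁ ξ₂, Lp.coeFn_sub u₁ u₂] with x h1 h2 h3 h4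
  rw [h3, h4]
  exact subdiff_monotone h1 h2

lemma neg_mul_sq_le_inner_of_lipschitz {K : Type*} [NormedAddCommGroup K] [InnerProductSpace ℝ K]
    {L : ℝ≥0} {N : K → K} (hN : LipschitzWith L N) (f g : K) :
    -(L * ‖f - g‖ ^ 2) ≤ inner ℝ (N f - N g) (f - g) := by
  have h1 := neg_le_of_abs_le (abs_real_inner_le_norm (N f - N g) (f - g))
  have h2 := mul_le_mul_of_nonneg_right (hN.norm_sub_le f g) (norm_nonneg (f - g))
  nlinarith

lemma two_mul_inner_le {K : Type*} [NormedAddCommGroup K] [InnerProductSpace ℝ K] (f g : K) :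
    2 * inner ℝ f g ≤ ‖f‖ ^ 2 + ‖g‖ ^ 2 := by
  nlinarith [real_inner_le_norm f g, sq_nonneg (‖f‖ - ‖g‖)]

/-- The difference of the two equations tested with the difference of the two solutions: the
subdifferentials are monotone, and the perturbations are Lipschitz continuous. -/
lemma dissipation_inequality {Ω : Set (Euc d)} {T : ℝ} {b bΓ : ℝ → ℝ≥0∞} {π πΓ : ℝ → ℝ}
    {D₁ D₂ : Data Ω T} {S₁ S₂ : Quadruplet Ω} {ut₁ ut₂ : ℝ → StrongDual ℝ (H1 Ω)}
    {vt₁ vt₂ : ℝ → StrongDual ℝ (HHalf Ω)} {t : ℝ} {L LΓ : ℝ≥0}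
    {N : L2 Ω → L2 Ω} (hN : ∀ f, N f =ᵐ[volume.restrict Ω] fun x => π (f x))
    (hNL : LipschitzWith L N)
    {NΓ : L2Bdry Ω → L2Bdry Ω} (hNΓ : ∀ f, NΓ f =ᵐ[surf Ω] fun x => πΓ (f x))
    (hNΓL : LipschitzWith LΓ NΓ)
    (h₁ : Equation π πΓ D₁ S₁ ut₁ vt₁ t (S₁.u t - S₂.u t) (S₁.v t - S₂.v t))
    (h₂ : Equation π πΓ D₂ S₂ ut₂ vt₂ t (S₁.u t - S₂.u t) (S₁.v t - S₂.v t))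
    (hξ₁ : ∀ᵐ x ∂volume.restrict Ω, S₁.ξ t x ∈ subdiff b (H1.toL2 Ω (S₁.u t) x))
    (hξ₂ : ∀ᵐ x ∂volume.restrict Ω, S₂.ξ t x ∈ subdiff b (H1.toL2 Ω (S₂.u t) x))
    (hξΓ₁ : S₁.ξΓ t ∈ subdiffDual (bdryFunctional Ω bΓ) (S₁.v t))
    (hξΓ₂ : S₂.ξΓ t ∈ subdiffDual (bdryFunctional Ω bΓ) (S₂.v t)) :
    2 * (ut₁ t - ut₂ t) (S₁.u t - S₂.u t) + 2 * (vt₁ t - vt₂ t) (S₁.v t - S₂.v t)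
      + 2 * ‖H1.grad Ω (S₁.u t - S₂.u t)‖ ^ 2
    ≤ ‖D₁.f t - D₂.f t‖ ^ 2 + ‖D₁.fΓ t - D₂.fΓ t‖ ^ 2
      + (2 * L + 2 * LΓ + 1) * (‖H1.toL2 Ω (S₁.u t - S₂.u t)‖ ^ 2
        + ‖HHalf.toL2 Ω (S₁.v t - S₂.v t)‖ ^ 2) := by
  have e₁ := h₁.inner_form hN hNΓ
  have e₂ := h₂.inner_form hN hNΓ
  have m1 := inner_sub_nonneg_of_mem_subdiff hξ₁ hξ₂
  have m2 := subdiffDual_monotone hξΓ₁ hξΓ₂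
  have l1 := neg_mul_sq_le_inner_of_lipschitz hNL (H1.toL2 Ω (S₁.u t)) (H1.toL2 Ω (S₂.u t))
  have l2 := neg_mul_sq_le_inner_of_lipschitz hNΓL (HHalf.toL2 Ω (S₁.v t))
    (HHalf.toL2 Ω (S₂.v t))
  have y1 := two_mul_inner_le (D₁.f t - D₂.f t) (H1.toL2 Ω (S₁.u t - S₂.u t))
  have y2 := two_mul_inner_le (D₁.fΓ t - D₂.fΓ t) (HHalf.toL2 Ω (S₁.v t - S₂.v t))
  have g1 : inner ℝ (H1.grad Ω (S₁.u t)) (H1.grad Ω (S₁.u t - S₂.u t))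
      - inner ℝ (H1.grad Ω (S₂.u t)) (H1.grad Ω (S₁.u t - S₂.u t))
      = ‖H1.grad Ω (S₁.u t - S₂.u t)‖ ^ 2 := by
    rw [← inner_sub_left, ← map_sub, real_inner_self_eq_norm_sq]
  rw [← map_sub] at m1 l1 l2
  rw [inner_sub_left] at m1 l1 l2 y1 y2
  rw [inner_add_left] at e₁ e₂
  simp only [sub_apply] at m2 ⊢
  have p1 : 0 ≤ (LΓ : ℝ) * ‖H1.toL2 Ω (S₁.u t - S₂.u t)‖ ^ 2 := by positivity
  have p2 : 0 ≤ (L : ℝ) * ‖HHalf.toL2 Ω (S₁.v t - S₂.v t)‖ ^ 2 := by positivity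
  linarith

/-! ### Continuous dependence and uniqueness -/

lemma lintegral_enorm_sq_eq_ofReal {α E : Type*} [MeasurableSpace α] [NormedAddCommGroup E]
    {μ : Measure α} {f : α → E} (hf : MemLp f 2 μ) :
    ∫⁻ x, ‖f x‖ₑ ^ 2 ∂μ = ENNReal.ofReal (∫ x, ‖f x‖ ^ 2 ∂μ) := by
  rw [ofReal_integral_eq_lintegral_ofReal hf.norm.integrable_sq
    (ae_of_all _ fun x => by positivity)]
  refine lintegral_congr fun x => ?_
  rw [ENNReal.ofReal_pow (norm_nonneg _), ofReal_norm]

lemma eLpNorm_top_sq_le_of_ae_sq_le {α E : Type*} [MeasurableSpace α] [NormedAddCommGroup E]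
    {μ : Measure α} {f : α → E} {C : ℝ} (h : ∀ᵐ x ∂μ, ‖f x‖ ^ 2 ≤ C) :
    eLpNorm f ⊤ μ ^ 2 ≤ ENNReal.ofReal C := by
  rcases le_or_gt 0 C with hC | hC
  · have h1 : eLpNorm f ⊤ μ ≤ ENNReal.ofReal √C := by
      rw [eLpNorm_exponent_top]
      exact eLpNormEssSup_le_of_ae_bound (h.mono fun x hx => Real.le_sqrt_of_sq_le hx)
    calc eLpNorm f ⊤ μ ^ 2 ≤ ENNReal.ofReal √C ^ 2 := by gcongr
      _ = ENNReal.ofReal C := by rw [← ENNReal.ofReal_pow (Real.sqrt_nonneg _), Real.sq_sqrt hC]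
  · have h0 : f =ᵐ[μ] 0 := h.mono fun x hx => absurd hx (not_le.2 (hC.trans_le (sq_nonneg _)))
    simp [eLpNorm_congr_ae h0]

/-- Gronwall's inequality for an energy `e` with `e' = U` and `U + G ≤ F + M e`, where `G` is the
dissipation and `F` the forcing. -/
lemma energy_gronwall {e G F U : ℝ → ℝ} {M T : ℝ} (hT : 0 < T) (hM : 0 ≤ M)
    (he : ContinuousOn e (Icc 0 T)) (he0 : 0 ≤ e 0) (hG0 : ∀ s, 0 ≤ G s) (hF0 : ∀ s, 0 ≤ F s)
    (hG : Integrable G (timeMeasure T)) (hF : Integrable F (timeMeasure T))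
    (hU : Integrable U (timeMeasure T))
    (heU : ∀ t ∈ Ioo 0 T, e t - e 0 = ∫ s in (0 : ℝ)..t, U s)
    (hle : ∀ᵐ t ∂timeMeasure T, U t + G t ≤ F t + M * e t) :
    ∀ t ∈ Icc 0 T, e t + ∫ s in (0 : ℝ)..t, G s
      ≤ (e 0 + ∫ s, F s ∂timeMeasure T) * Real.exp (M * T) := by
  have hei : ∀ {f : ℝ → ℝ} {t : ℝ}, ContinuousOn f (Icc 0 T) → t ∈ Ioo 0 T →
      IntervalIntegrable f volume 0 t := fun hf ht =>
    (hf.mono (Icc_subset_Icc_right ht.2.le)).intervalIntegrable_of_Icc ht.1.le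
  have hGc : ContinuousOn (fun t => ∫ s in (0 : ℝ)..t, G s) (Icc 0 T) := by
    have h : IntegrableOn G (uIcc 0 T) := by
      rw [uIcc_of_le hT.le, integrableOn_Icc_iff_integrableOn_Ioo]; exact hG
    have := intervalIntegral.continuousOn_primitive_interval h
    rwa [uIcc_of_le hT.le] at this
  have hyc : ContinuousOn (fun t => e t + ∫ s in (0 : ℝ)..t, G s) (Icc 0 T) := he.add hGc
  refine gronwall_integral hT (add_nonneg he0 (integral_nonneg hF0)) hM hyc fun t ht => ?_
  have I1 : (∫ s in (0 : ℝ)..t, U s) + ∫ s in (0 : ℝ)..t, G s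
      ≤ (∫ s in (0 : ℝ)..t, F s) + M * ∫ s in (0 : ℝ)..t, e s := by
    have iU := intervalIntegrable_of_timeMeasure hU ht
    have iG := intervalIntegrable_of_timeMeasure hG ht
    have iF := intervalIntegrable_of_timeMeasure hF ht
    rw [← intervalIntegral.integral_add iU iG, ← intervalIntegral.integral_const_mul,
      ← intervalIntegral.integral_add iF ((hei he ht).const_mul M)]
    refine intervalIntegral.integral_mono_ae_restrict ht.1.le
      (iU.add iG) (iF.add ((hei he ht).const_mul M)) ?_
    rw [← Measure.restrict_congr_set Ioo_ae_eq_Icc]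
    exact ae_mono (Measure.restrict_mono (Ioo_subset_Ioo_right ht.2.le) le_rfl) hle
  have I2 : ∫ s in (0 : ℝ)..t, F s ≤ ∫ s, F s ∂timeMeasure T := by
    rw [intervalIntegral.integral_of_le ht.1.le, integral_Ioc_eq_integral_Ioo]
    exact integral_mono_measure (Measure.restrict_mono (Ioo_subset_Ioo_right ht.2.le) le_rfl)
      (ae_of_all _ hF0) hF
  have I3 : ∫ s in (0 : ℝ)..t, e s
      ≤ ∫ s in (0 : ℝ)..t, (e s + ∫ r in (0 : ℝ)..s, G r) := by
    refine intervalIntegral.integral_mono_on ht.1.le (hei he ht) (hei hyc ht) fun s hs => ?_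
    have := intervalIntegral.integral_nonneg (μ := volume) hs.1 fun r _ => hG0 r
    linarith
  have I4 := mul_le_mul_of_nonneg_left I3 hM
  linarith [heU t ht]

lemma HasInitialValue.sub {K : Type*} [NormedAddCommGroup K] {T : ℝ} {f₁ f₂ : ℝ → K} {a₁ a₂ : K}
    (h₁ : HasInitialValue T f₁ a₁) (h₂ : HasInitialValue T f₂ a₂) :
    HasInitialValue T (fun t => f₁ t - f₂ t) (a₁ - a₂) := by
  obtain ⟨g₁, c₁, e₁, i₁⟩ := h₁
  obtain ⟨g₂, c₂, e₂, i₂⟩ := h₂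
  exact ⟨fun t => g₁ t - g₂ t, c₁.sub c₂, e₁.sub e₂, by simp only [i₁, i₂]⟩

/-- The weak time derivative of the difference of two functions, embedded by the pivot map. -/
lemma HasWeakTimeDeriv.pivot_sub {X K : Type*} [NormedAddCommGroup X] [NormedSpace ℝ X]
    [NormedAddCommGroup K] [InnerProductSpace ℝ K] {j : X →L[ℝ] K} {T : ℝ} {u₁ u₂ : ℝ → X}
    {g₁ g₂ : ℝ → StrongDual ℝ X}
    (h₁ : HasWeakTimeDeriv T (fun t => pivot j (u₁ t)) g₁)
    (h₂ : HasWeakTimeDeriv T (fun t => pivot j (u₂ t)) g₂)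
    (hu₁ : MemLp u₁ 2 (timeMeasure T)) (hu₂ : MemLp u₂ 2 (timeMeasure T))
    (hg₁ : MemLp g₁ 2 (timeMeasure T)) (hg₂ : MemLp g₂ 2 (timeMeasure T)) :
    HasWeakTimeDeriv T (fun t => pivot j (u₁ t - u₂ t)) (fun t => g₁ t - g₂ t) := by
  have h := h₁.sub h₂ (memLp_pivot hu₁) (memLp_pivot hu₂) hg₁ hg₂
  simpa only [← pivotL_apply, map_sub] using h

/-- The basic estimate, in terms of the continuous representatives `gu` and `gv` of `u₁ - u₂` and
`v₁ - v₂`. -/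
lemma exists_continuous_energy_le (hd : 1 ≤ d) {Ω : Set (Euc d)} (hΩ : IsSmoothBoundedDomain Ω)
    {T : ℝ} (hT : 0 < T) {L LΓ : ℝ≥0} {b bΓ : ℝ → ℝ≥0∞} {π πΓ : ℝ → ℝ}
    (hπ : LipschitzWith L π) (hπΓ : LipschitzWith LΓ πΓ) {D₁ D₂ : Data Ω T}
    {S₁ S₂ : Quadruplet Ω} (h₁ : IsSolution b bΓ π πΓ D₁ S₁) (h₂ : IsSolution b bΓ π πΓ D₂ S₂) :
    ∃ (gu : ℝ → L2 Ω) (gv : ℝ → L2Bdry Ω),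
      (fun t => H1.toL2 Ω (S₁.u t - S₂.u t)) =ᵐ[timeMeasure T] gu ∧
      (fun t => HHalf.toL2 Ω (S₁.v t - S₂.v t)) =ᵐ[timeMeasure T] gv ∧
      ∀ t ∈ Icc 0 T, ‖gu t‖ ^ 2 + ‖gv t‖ ^ 2
          + ∫ s in (0 : ℝ)..t, 2 * ‖H1.grad Ω (S₁.u s - S₂.u s)‖ ^ 2
        ≤ (‖D₁.u₀ - D₂.u₀‖ ^ 2 + ‖D₁.v₀ - D₂.v₀‖ ^ 2
            + ∫ s, (‖D₁.f s - D₂.f s‖ ^ 2 + ‖D₁.fΓ s - D₂.fΓ s‖ ^ 2) ∂timeMeasure T)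
          * Real.exp ((2 * L + 2 * LΓ + 1) * T) := by
  have := hΩ.isFiniteMeasure_volume
  have := hΩ.isFiniteMeasure_surf hd
  obtain ⟨N, hN, hNL⟩ := exists_nemytskii (volume.restrict Ω) hπ
  obtain ⟨NΓ, hNΓ, hNΓL⟩ := exists_nemytskii (surf Ω) hπΓ
  obtain ⟨ut₁, vt₁, mut₁, dut₁, mvt₁, dvt₁, eq₁⟩ := h₁.equation
  obtain ⟨ut₂, vt₂, mut₂, dut₂, mvt₂, dvt₂, eq₂⟩ := h₂.equation
  obtain ⟨gu, cgu, hgu, iu⟩ := h₁.init_u.sub h₂.init_u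
  obtain ⟨gv, cgv, hgv, iv⟩ := h₁.init_v.sub h₂.init_v
  simp only [← map_sub] at hgu hgv
  have hu : MemLp (fun t => S₁.u t - S₂.u t) 2 (timeMeasure T) := h₁.memLp_u.sub h₂.memLp_u
  have hv : MemLp (fun t => S₁.v t - S₂.v t) 2 (timeMeasure T) := h₁.memLp_v.sub h₂.memLp_v
  have hut : MemLp (fun t => ut₁ t - ut₂ t) 2 (timeMeasure T) := mut₁.sub mut₂
  have hvt : MemLp (fun t => vt₁ t - vt₂ t) 2 (timeMeasure T) := mvt₁.sub mvt₂
  have hdu := dut₁.pivot_sub dut₂ h₁.memLp_u h₂.memLp_u mut₁ mut₂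
  have hdv := dvt₁.pivot_sub dvt₂ h₁.memLp_v h₂.memLp_v mvt₁ mvt₂
  have hU := (integrable_dual_apply hut hu).const_mul 2
  have hV := (integrable_dual_apply hvt hv).const_mul 2
  have hG : Integrable (fun t => 2 * ‖H1.grad Ω (S₁.u t - S₂.u t)‖ ^ 2) (timeMeasure T) :=
    (((H1.grad Ω).comp_memLp' hu).norm.integrable_sq).const_mul 2
  have hF : Integrable (fun s => ‖D₁.f s - D₂.f s‖ ^ 2 + ‖D₁.fΓ s - D₂.fΓ s‖ ^ 2)
      (timeMeasure T) :=
    ((D₁.memLp_f.sub D₂.memLp_f).norm.integrable_sq).add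
      ((D₁.memLp_fΓ.sub D₂.memLp_fΓ).norm.integrable_sq)
  refine ⟨gu, gv, hgu, hgv, ?_⟩
  rw [← iu, ← iv]
  refine energy_gronwall (e := fun t => ‖gu t‖ ^ 2 + ‖gv t‖ ^ 2) hT (by positivity)
    ((cgu.norm.pow 2).add (cgv.norm.pow 2)) (by positivity) (fun s => by positivity)
    (fun s => by positivity) hG hF (hU.add hV) (fun t ht => ?_) ?_
  · have E1 := energy_identity hu hut hdu cgu hgu ht.1 ht.2
    have E2 := energy_identity hv hvt hdv cgv hgv ht.1 ht.2
    simp only [Pi.add_apply]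
    rw [intervalIntegral.integral_add (intervalIntegrable_of_timeMeasure hU ht)
      (intervalIntegrable_of_timeMeasure hV ht), ← E1, ← E2]
    ring
  · filter_upwards [eq₁, eq₂, h₁.trace, h₂.trace, h₁.ξ_mem, h₂.ξ_mem, h₁.ξΓ_mem, h₂.ξΓ_mem, hgu,
      hgv] with t e1 e2 t1 t2 x1 x2 y1 y2 gu gv
    have htr : IsTrace Ω (S₁.u t - S₂.u t) (HHalf.toL2 Ω (S₁.v t - S₂.v t)) := by
      rw [map_sub]; exact t1.sub t2
    rw [← gu, ← gv]
    exact dissipation_inequality hN hNL hNΓ hNΓL (e1 _ _ htr) (e2 _ _ htr) x1 x2 y1 y2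

/-- The continuous dependence estimate, with the constant `3 exp((2L + 2LΓ + 1)T)`. -/
theorem continuous_dependence (hd : 1 ≤ d) {Ω : Set (Euc d)} (hΩ : IsSmoothBoundedDomain Ω)
    {T : ℝ} (hT : 0 < T) {L LΓ : ℝ≥0} {b bΓ : ℝ → ℝ≥0∞} {π πΓ : ℝ → ℝ}
    (hπ : LipschitzWith L π) (hπΓ : LipschitzWith LΓ πΓ) {D₁ D₂ : Data Ω T}
    {S₁ S₂ : Quadruplet Ω} (h₁ : IsSolution b bΓ π πΓ D₁ S₁) (h₂ : IsSolution b bΓ π πΓ D₂ S₂) :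
    eLpNorm (fun t => H1.toL2 Ω (S₁.u t) - H1.toL2 Ω (S₂.u t)) ⊤ (timeMeasure T) ^ 2
      + eLpNorm (fun t => H1.grad Ω (S₁.u t) - H1.grad Ω (S₂.u t)) 2 (timeMeasure T) ^ 2
      + eLpNorm (fun t => HHalf.toL2 Ω (S₁.v t) - HHalf.toL2 Ω (S₂.v t)) ⊤ (timeMeasure T) ^ 2
    ≤ ((3 * Real.toNNReal (Real.exp ((2 * L + 2 * LΓ + 1) * T)) : ℝ≥0) : ℝ≥0∞)
      * (‖D₁.u₀ - D₂.u₀‖ₑ ^ 2 + ‖D₁.v₀ - D₂.v₀‖ₑ ^ 2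
        + eLpNorm (fun t => D₁.f t - D₂.f t) 2 (timeMeasure T) ^ 2
        + eLpNorm (fun t => D₁.fΓ t - D₂.fΓ t) 2 (timeMeasure T) ^ 2) := by
  obtain ⟨gu, gv, hgu, hgv, hle⟩ := exists_continuous_energy_le hd hΩ hT hπ hπΓ h₁ h₂
  have hf := D₁.memLp_f.sub D₂.memLp_f
  have hfΓ := D₁.memLp_fΓ.sub D₂.memLp_fΓ
  have hg : MemLp (fun t => H1.grad Ω (S₁.u t - S₂.u t)) 2 (timeMeasure T) :=
    (H1.grad Ω).comp_memLp' (h₁.memLp_u.sub h₂.memLp_u)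
  simp only [← map_sub]
  set E := Real.exp ((2 * L + 2 * LΓ + 1) * T)
  set A := ‖D₁.u₀ - D₂.u₀‖ ^ 2 + ‖D₁.v₀ - D₂.v₀‖ ^ 2
    + ∫ s, (‖D₁.f s - D₂.f s‖ ^ 2 + ‖D₁.fΓ s - D₂.fΓ s‖ ^ 2) ∂timeMeasure T with hA
  have hdata : ‖D₁.u₀ - D₂.u₀‖ₑ ^ 2 + ‖D₁.v₀ - D₂.v₀‖ₑ ^ 2
        + eLpNorm (fun t => D₁.f t - D₂.f t) 2 (timeMeasure T) ^ 2
        + eLpNorm (fun t => D₁.fΓ t - D₂.fΓ t) 2 (timeMeasure T) ^ 2 = ENNReal.ofReal A := by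
    have p1 : 0 ≤ ∫ s, ‖D₁.f s - D₂.f s‖ ^ 2 ∂timeMeasure T :=
      integral_nonneg fun s => by positivity
    have p2 : 0 ≤ ∫ s, ‖D₁.fΓ s - D₂.fΓ s‖ ^ 2 ∂timeMeasure T :=
      integral_nonneg fun s => by positivity
    have e1 : ∫⁻ s, ‖D₁.f s - D₂.f s‖ₑ ^ 2 ∂timeMeasure T = _ := lintegral_enorm_sq_eq_ofReal hf
    have e2 : ∫⁻ s, ‖D₁.fΓ s - D₂.fΓ s‖ₑ ^ 2 ∂timeMeasure T = _ :=
      lintegral_enorm_sq_eq_ofReal hfΓ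
    have i1 : Integrable (fun s => ‖D₁.f s - D₂.f s‖ ^ 2) (timeMeasure T) :=
      hf.norm.integrable_sq
    have i2 : Integrable (fun s => ‖D₁.fΓ s - D₂.fΓ s‖ ^ 2) (timeMeasure T) :=
      hfΓ.norm.integrable_sq
    have e3 : A = ‖D₁.u₀ - D₂.u₀‖ ^ 2 + ‖D₁.v₀ - D₂.v₀‖ ^ 2
        + ∫ s, ‖D₁.f s - D₂.f s‖ ^ 2 ∂timeMeasure T
        + ∫ s, ‖D₁.fΓ s - D₂.fΓ s‖ ^ 2 ∂timeMeasure T := by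
      rw [hA, integral_add i1 i2, ← add_assoc]
    rw [eLpNorm_two_sq, eLpNorm_two_sq, e1, e2, e3, ENNReal.ofReal_add (by positivity) p2,
      ENNReal.ofReal_add (by positivity) p1, ENNReal.ofReal_add (by positivity) (by positivity),
      ENNReal.ofReal_pow (norm_nonneg _), ENNReal.ofReal_pow (norm_nonneg _),
      ofReal_norm, ofReal_norm]
  have hint : ∀ t ∈ Icc 0 T,
      0 ≤ ∫ s in (0 : ℝ)..t, 2 * ‖H1.grad Ω (S₁.u s - S₂.u s)‖ ^ 2 := fun t ht =>
    intervalIntegral.integral_nonneg ht.1 fun s _ => by positivity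
  have hmem : ∀ᵐ t ∂timeMeasure T, t ∈ Icc 0 T :=
    ae_restrict_of_forall_mem measurableSet_Ioo fun t ht => Ioo_subset_Icc_self ht
  have b1 : eLpNorm (fun t => H1.toL2 Ω (S₁.u t - S₂.u t)) ⊤ (timeMeasure T) ^ 2
      ≤ ENNReal.ofReal (A * E) := by
    refine eLpNorm_top_sq_le_of_ae_sq_le ?_
    filter_upwards [hgu, hmem] with t h1 h2
    rw [h1]
    linarith [hle t h2, hint t h2, sq_nonneg ‖gv t‖]
  have b3 : eLpNorm (fun t => HHalf.toL2 Ω (S₁.v t - S₂.v t)) ⊤ (timeMeasure T) ^ 2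
      ≤ ENNReal.ofReal (A * E) := by
    refine eLpNorm_top_sq_le_of_ae_sq_le ?_
    filter_upwards [hgv, hmem] with t h1 h2
    rw [h1]
    linarith [hle t h2, hint t h2, sq_nonneg ‖gu t‖]
  have b2 : eLpNorm (fun t => H1.grad Ω (S₁.u t - S₂.u t)) 2 (timeMeasure T) ^ 2
      ≤ ENNReal.ofReal (A * E) := by
    rw [eLpNorm_two_sq, lintegral_enorm_sq_eq_ofReal hg]
    refine ENNReal.ofReal_le_ofReal ?_
    -- The dissipation is bounded by the estimate at the final time.
    have h1 := hle T ⟨hT.le, le_rfl⟩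
    rw [intervalIntegral.integral_const_mul, intervalIntegral.integral_of_le hT.le,
      integral_Ioc_eq_integral_Ioo] at h1
    have h2 : 0 ≤ ∫ s, ‖H1.grad Ω (S₁.u s - S₂.u s)‖ ^ 2 ∂timeMeasure T :=
      integral_nonneg fun s => by positivity
    linarith [sq_nonneg ‖gu T‖, sq_nonneg ‖gv T‖]
  rw [hdata]
  have hE : ENNReal.ofReal (A * E) = (Real.toNNReal E : ℝ≥0∞) * ENNReal.ofReal A := by
    rw [mul_comm A E, ENNReal.ofReal_mul (Real.exp_pos _).le]
    rfl
  calc _ ≤ ENNReal.ofReal (A * E) + ENNReal.ofReal (A * E) + ENNReal.ofReal (A * E) := by gcongr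
    _ = _ := by
      rw [hE]
      push_cast
      ring

/-- A pair `(ξ, ξΓ)` that annihilates all pairs `(z, z|_Γ)` vanishes: first `ξ = 0`, by testing with
functions supported in `Ω`, and then `ξΓ = 0`. -/
lemma eq_zero_of_forall_isTrace {Ω : Set (Euc d)} (hΩ : IsOpen Ω) {ξ : L2 Ω}
    {ξΓ : StrongDual ℝ (HHalf Ω)}
    (h : ∀ (z : H1 Ω) (w : HHalf Ω), IsTrace Ω z (HHalf.toL2 Ω w) →
      inner ℝ ξ (H1.toL2 Ω z) + ξΓ w = 0) : ξ = 0 ∧ ξΓ = 0 := by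
  have hξ : ξ = 0 := by
    have hli : LocallyIntegrableOn ξ Ω volume :=
      (locallyIntegrableOn_of_locallyIntegrable_restrict
        ((Lp.memLp ξ).locallyIntegrable (by norm_num)))
    have h0 := hΩ.ae_eq_zero_of_integral_contDiff_smul_eq_zero hli fun φ k kc ks => by
      obtain ⟨z, hz, htr⟩ := exists_H1_isTrace_zero hΩ k kc ks
      have h1 := h z 0 (by rwa [map_zero])
      rw [map_zero, add_zero, ← integral_mul_eq_inner] at h1
      rw [← setIntegral_eq_integral_of_forall_compl_eq_zero (s := Ω) (fun t ht => by
        rw [image_eq_zero_of_notMem_tsupport fun h' => ht (ks h'), zero_smul]), ← h1]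
      refine integral_congr_ae ?_
      filter_upwards [hz] with x hx
      rw [hx, smul_eq_mul, mul_comm]
    refine Lp.ext ?_
    filter_upwards [(ae_restrict_iff' hΩ.measurableSet).2 h0, Lp.coeFn_zero ℝ 2
      (volume.restrict Ω)] with x h1 h2
    rw [h1, h2, Pi.zero_apply]
  refine ⟨hξ, ContinuousLinearMap.ext fun w => ?_⟩
  obtain ⟨z, hz⟩ := HHalf.exists_isTrace w
  simpa [hξ] using h z w hz

/-- Two solutions with the same data coincide. -/
theorem uniqueness (hd : 1 ≤ d) {Ω : Set (Euc d)} (hΩ : IsSmoothBoundedDomain Ω)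
    {T : ℝ} (hT : 0 < T) {L LΓ : ℝ≥0} {b bΓ : ℝ → ℝ≥0∞} {π πΓ : ℝ → ℝ}
    (hπ : LipschitzWith L π) (hπΓ : LipschitzWith LΓ πΓ) {D : Data Ω T}
    {S₁ S₂ : Quadruplet Ω} (h₁ : IsSolution b bΓ π πΓ D S₁) (h₂ : IsSolution b bΓ π πΓ D S₂) :
    S₁.u =ᵐ[timeMeasure T] S₂.u ∧ S₁.v =ᵐ[timeMeasure T] S₂.v ∧
      S₁.ξ =ᵐ[timeMeasure T] S₂.ξ ∧ S₁.ξΓ =ᵐ[timeMeasure T] S₂.ξΓ := by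
  have hest := continuous_dependence hd hΩ hT hπ hπΓ h₁ h₂
  simp only [sub_self, enorm_zero, eLpNorm_zero', ne_eq, OfNat.ofNat_ne_zero, not_false_eq_true,
    zero_pow, add_zero, mul_zero, nonpos_iff_eq_zero, add_eq_zero, pow_eq_zero_iff] at hest
  obtain ⟨⟨z1, z2⟩, z3⟩ := hest
  have m1 := (H1.toL2 Ω).comp_memLp' h₁.memLp_u |>.sub ((H1.toL2 Ω).comp_memLp' h₂.memLp_u)
  have m2 := (H1.grad Ω).comp_memLp' h₁.memLp_u |>.sub ((H1.grad Ω).comp_memLp' h₂.memLp_u)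
  have m3 := (HHalf.toL2 Ω).comp_memLp' h₁.memLp_v |>.sub
    ((HHalf.toL2 Ω).comp_memLp' h₂.memLp_v)
  have z1' := (eLpNorm_eq_zero_iff m1.1 (by simp)).1 z1
  have z2' := (eLpNorm_eq_zero_iff m2.1 (by simp)).1 z2
  have z3' := (eLpNorm_eq_zero_iff m3.1 (by simp)).1 z3
  have hu : S₁.u =ᵐ[timeMeasure T] S₂.u := by
    filter_upwards [z1', z2'] with t e1 e2
    exact H1.ext_of_toL2_grad (sub_eq_zero.1 e1) (sub_eq_zero.1 e2)
  have hv : S₁.v =ᵐ[timeMeasure T] S₂.v := by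
    filter_upwards [z3'] with t e
    exact HHalf.toL2_injective Ω (sub_eq_zero.1 e)
  have := hΩ.isFiniteMeasure_volume
  have := hΩ.isFiniteMeasure_surf hd
  obtain ⟨N, hN, -⟩ := exists_nemytskii (volume.restrict Ω) hπ
  obtain ⟨NΓ, hNΓ, -⟩ := exists_nemytskii (surf Ω) hπΓ
  obtain ⟨ut₁, vt₁, mut₁, dut₁, mvt₁, dvt₁, eq₁⟩ := h₁.equation
  obtain ⟨ut₂, vt₂, mut₂, dut₂, mvt₂, dvt₂, eq₂⟩ := h₂.equation
  -- Now all terms of the two equations agree, except those with `ξ` and `ξΓ`.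
  have hut : ut₁ =ᵐ[timeMeasure T] ut₂ :=
    dut₁.ae_eq dut₂ (hu.fun_comp (pivot (H1.toL2 Ω))) mut₁ mut₂
  have hvt : vt₁ =ᵐ[timeMeasure T] vt₂ :=
    dvt₁.ae_eq dvt₂ (hv.fun_comp (pivot (HHalf.toL2 Ω))) mvt₁ mvt₂
  have hξ : ∀ᵐ t ∂timeMeasure T, S₁.ξ t - S₂.ξ t = 0 ∧ S₁.ξΓ t - S₂.ξΓ t = 0 := by
    filter_upwards [hu, hv, hut, hvt, eq₁, eq₂] with t e1 e2 e3 e4 q1 q2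
    refine eq_zero_of_forall_isTrace hΩ.isOpen fun z w hzw => ?_
    have r1 := (q1 z w hzw).inner_form hN hNΓ
    have r2 := (q2 z w hzw).inner_form hN hNΓ
    rw [e1, e2, e3, e4, inner_add_left] at r1
    rw [inner_add_left] at r2
    rw [inner_sub_left, sub_apply]
    linarith
  exact ⟨hu, hv, hξ.mono fun t h => sub_eq_zero.1 h.1, hξ.mono fun t h => sub_eq_zero.1 h.2⟩

end AllenCahn

end

theorem mainTheorem4 {d : ℕ} (hd : 1 ≤ d) (Ω : Set (AllenCahn.Euc d))
    (hΩ : AllenCahn.IsSmoothBoundedDomain Ω) (T : ℝ) (hT : 0 < T) (L LΓ : ℝ≥0) :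
    ∃ c : ℝ≥0, ∀ (b bΓ : ℝ → ℝ≥0∞) (π πΓ : ℝ → ℝ),
      AllenCahn.IsPotential b → AllenCahn.IsPotential bΓ →
      LipschitzWith L π → LipschitzWith LΓ πΓ →
      (∀ (D₁ D₂ : AllenCahn.Data Ω T) (S₁ S₂ : AllenCahn.Quadruplet Ω),
        AllenCahn.IsSolution b bΓ π πΓ D₁ S₁ → AllenCahn.IsSolution b bΓ π πΓ D₂ S₂ →
        eLpNorm (fun t => AllenCahn.H1.toL2 Ω (S₁.u t) - AllenCahn.H1.toL2 Ω (S₂.u t)) ⊤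
              (AllenCahn.timeMeasure T) ^ 2
          + eLpNorm (fun t => AllenCahn.H1.grad Ω (S₁.u t) - AllenCahn.H1.grad Ω (S₂.u t)) 2
              (AllenCahn.timeMeasure T) ^ 2
          + eLpNorm (fun t => AllenCahn.HHalf.toL2 Ω (S₁.v t) - AllenCahn.HHalf.toL2 Ω (S₂.v t)) ⊤
              (AllenCahn.timeMeasure T) ^ 2
          ≤ (c : ℝ≥0∞) * (‖D₁.u₀ - D₂.u₀‖ₑ ^ 2 + ‖D₁.v₀ - D₂.v₀‖ₑ ^ 2
            + eLpNorm (fun t => D₁.f t - D₂.f t) 2 (AllenCahn.timeMeasure T) ^ 2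
            + eLpNorm (fun t => D₁.fΓ t - D₂.fΓ t) 2 (AllenCahn.timeMeasure T) ^ 2)) ∧
      (∀ (D : AllenCahn.Data Ω T) (S₁ S₂ : AllenCahn.Quadruplet Ω),
        AllenCahn.IsSolution b bΓ π πΓ D S₁ → AllenCahn.IsSolution b bΓ π πΓ D S₂ →
        S₁.u =ᵐ[AllenCahn.timeMeasure T] S₂.u ∧ S₁.v =ᵐ[AllenCahn.timeMeasure T] S₂.v ∧
        S₁.ξ =ᵐ[AllenCahn.timeMeasure T] S₂.ξ ∧ S₁.ξΓ =ᵐ[AllenCahn.timeMeasure T] S₂.ξΓ) := by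
  refine ⟨3 * Real.toNNReal (Real.exp ((2 * L + 2 * LΓ + 1) * T)),
    fun b bΓ π πΓ _ _ hπ hπΓ => ⟨fun D₁ D₂ S₁ S₂ h₁ h₂ => ?_, fun D S₁ S₂ h₁ h₂ => ?_⟩⟩
  · exact AllenCahn.continuous_dependence hd hΩ hT hπ hπΓ h₁ h₂
  · exact AllenCahn.uniqueness hd hΩ hT hπ hπΓ h₁ h₂
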